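/- All graphs are finite and simple. A realisation $p\colon V(G)\to\mathbb{R}^2$ is generic if its coordinates are algebraically independent over $\mathbb{Q}$. A continuous motion of $(G,p)$ is a continuous map $\phi\colon(-1,1)\times V(G)\to\mathbb{R}^2$ such that $\phi_0=p$ and every $\phi_t$ gives all edges of $G$ the same lengths as $p$; it is trivial if, for every $t$, all pairs of vertices have the same distance in $\phi_t$ as in $p$. The framework $(G,p)$ is flexible if it has a non-trivial continuous motion, and rigid otherwise; $G$ is rigid (flexible) if its generic realisations in $\mathbb{R}^2$ are rigid (flexible). $G$ is minimally rigid if $G$ is rigid but $G-e$ is flexible for every $e\in E(G)$. A NAC-colouring of $G$ is a surjective map $c\colon E(G)\to\{\mathrm{red},\mathrm{blue}\}$ such that every cycle of $G$ is either monochromatic or contains at least two red and at least two blue edges; $\nu(G)$ denotes the number of NAC-colourings of $G$ divided by $2$. Let $H$ be the graph on the vertices $0,1,\dots,17$ with the $33$ edges $\{0,1\}$, $\{0,5\}$, $\{0,9\}$, $\{1,2\}$, $\{1,4\}$, $\{1,6\}$, $\{1,10\}$, $\{1,11\}$, $\{1,12\}$, $\{1,14\}$, $\{1,16\}$, $\{2,3\}$,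 $\{2,5\}$, $\{3,4\}$, $\{3,8\}$, $\{3,11\}$, $\{4,5\}$, $\{5,6\}$, $\{5,10\}$, $\{5,11\}$, $\{5,12\}$, $\{5,14\}$, $\{5,16\}$, $\{6,7\}$, $\{7,8\}$, $\{8,9\}$, $\{8,13\}$, $\{8,15\}$, $\{8,17\}$, $\{9,10\}$, $\{12,13\}$, $\{14,15\}$, $\{16,17\}$. **Corollary 5.6.** There is an infinite family of minimally rigid graphs $H_k$ with $\nu(H_k)=\omega\bigl(2.13^{|V(H_k)|}\bigr)$. More precisely, $H$ is minimally rigid and $\nu(H)=180607$. Moreover, let $ab$ be any edge of $H$ and, for $k\ge 1$, let $H_k$ be obtained by gluing $k$ copies of $H$ along $ab$ (that is, from $k$ disjoint copies of $H$ by identifying all copies of $a$ with each other and all copies of $b$ with each other). Then, for every $k\ge1$, $H_k$ is minimally rigid, $|V(H_k)|=16k+2$ and $\nu(H_k)=(\nu(H)+1)^k-1$; and $$\lim_{k\to\infty}\frac{\nu(H_k)}{2.13^{|V(H_k)|}}=\infty .$$ -/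

import Mathlib

open Filter Asymptotics

/-! ### Rigidity -/

/-- A realisation of the vertex set `V` in Euclidean `d`-space. -/
abbrev Realisation (V : Type*) (d : ℕ) : Type _ := V → EuclideanSpace ℝ (Fin d)

/-- Two realisations of `G` are equivalent if all edges have the same lengths in both. -/
def RealisationEquivalent {V : Type*} {d : ℕ} (G : SimpleGraph V) (p q : Realisation V d) : Prop :=
  ∀ u v : V, G.Adj u v → ‖p u - p v‖ = ‖q u - q v‖

/-- Two realisations are congruent if all pairs of vertices have the same distances in both. -/
def RealisationCongruent {V : Type*} {d : ℕ} (p q : Realisation V d) : Prop :=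
  ∀ u v : V, ‖p u - p v‖ = ‖q u - q v‖

/-- `φ`, restricted to times in `(-1, 1)`, is a continuous motion of the framework `(G, p)`. -/
def IsContinuousMotion {V : Type*} {d : ℕ} (G : SimpleGraph V) (p : Realisation V d)
    (φ : ℝ → Realisation V d) : Prop :=
  (∀ v : V, ContinuousOn (fun t => φ t v) (Set.Ioo (-1) 1)) ∧ φ 0 = p ∧
    ∀ t ∈ Set.Ioo (-1 : ℝ) 1, RealisationEquivalent G p (φ t)

/-- A framework is flexible if it has a non-trivial continuous motion. -/
def FlexibleFramework {V : Type*} {d : ℕ} (G : SimpleGraph V) (p : Realisation V d) : Prop :=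
  ∃ φ : ℝ → Realisation V d, IsContinuousMotion G p φ ∧
    ¬ ∀ t ∈ Set.Ioo (-1 : ℝ) 1, RealisationCongruent p (φ t)

/-- A framework is rigid if it is not flexible. -/
def RigidFramework {V : Type*} {d : ℕ} (G : SimpleGraph V) (p : Realisation V d) : Prop :=
  ¬ FlexibleFramework G p

/-- A realisation is generic if its coordinates are algebraically independent over `ℚ`. -/
def GenericRealisation {V : Type*} {d : ℕ} (p : Realisation V d) : Prop :=
  AlgebraicIndependent ℚ (fun x : V × Fin d => p x.1 x.2)

/-- `G` is `d`-rigid if its generic realisations in `d`-space are rigid. -/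
def IsRigidGraph {V : Type*} (d : ℕ) (G : SimpleGraph V) : Prop :=
  ∀ p : Realisation V d, GenericRealisation p → RigidFramework G p

/-- `G` is `d`-flexible if its generic realisations in `d`-space are flexible. -/
def IsFlexibleGraph {V : Type*} (d : ℕ) (G : SimpleGraph V) : Prop :=
  ∀ p : Realisation V d, GenericRealisation p → FlexibleFramework G p

/-- `G` is minimally rigid (in the plane) if it is `2`-rigid, but deleting any edge makes it
`2`-flexible. -/
def IsMinimallyRigid {V : Type*} (G : SimpleGraph V) : Prop :=
  IsRigidGraph 2 G ∧ ∀ e ∈ G.edgeSet, IsFlexibleGraph 2 (G.deleteEdges {e})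

/-! ### NAC-colourings -/

/-- The edges of colour `b` on the closed walk `w`, for an edge colouring `c`. -/
def colouredEdges {V : Type*} {G : SimpleGraph V} (c : G.edgeSet → Bool) {v : V}
    (w : G.Walk v v) (b : Bool) : Set G.edgeSet :=
  {e | (e : Sym2 V) ∈ w.edges ∧ c e = b}

/-- A NAC-colouring of `G` is a surjective colouring of the edges with two colours
(`true` is red and `false` is blue) such that every cycle is either monochromatic or has at
least two edges of both colours. -/
def IsNACColouring {V : Type*} (G : SimpleGraph V) (c : G.edgeSet → Bool) : Prop :=
  Function.Surjective c ∧
    ∀ (v : V) (w : G.Walk v v), w.IsCycle →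
      (∃ b : Bool, ∀ e : G.edgeSet, (e : Sym2 V) ∈ w.edges → c e = b) ∨
        (2 ≤ (colouredEdges c w true).ncard ∧ 2 ≤ (colouredEdges c w false).ncard)

/-- The number of NAC-colourings of a finite graph, divided by two. -/
noncomputable def nnac {V : Type*} [Finite V] (G : SimpleGraph V) : ℝ :=
  ({c : G.edgeSet → Bool | IsNACColouring G c}.ncard : ℝ) / 2

/-! ### Gluing copies of a graph along an edge -/

/-- The vertices of the graph obtained by gluing `k` copies of a graph on `V` along `ab`:
the two common vertices and, for each copy, one vertex for every element of `V` other than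
`a` and `b`. -/
abbrev GlueVertex {V : Type*} (a b : V) (k : ℕ) : Type _ :=
  Fin 2 ⊕ (Fin k × {x : V // x ≠ a ∧ x ≠ b})

/-- The inclusion of the vertices of the `i`-th copy. -/
def glueInclusion {V : Type*} [DecidableEq V] (a b : V) (k : ℕ) (i : Fin k) (x : V) :
    GlueVertex a b k :=
  if ha : x = a then Sum.inl 0
  else if hb : x = b then Sum.inl 1
  else Sum.inr (i, ⟨x, ha, hb⟩)

/-- The graph obtained by gluing `k` copies of `H` along the edge `ab`: the union of the images
of `H` under the inclusions of the `k` copies. -/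
def glueCopies {V : Type*} [DecidableEq V] (H : SimpleGraph V) (a b : V) (k : ℕ) :
    SimpleGraph (GlueVertex a b k) :=
  ⨆ i : Fin k, H.map (glueInclusion a b k i)

/-! ### The explicit base graph -/

/-- The graph with vertices `0, …, 17` and the 33 edges listed. -/
def baseGraph : SimpleGraph (Fin 18) :=
  SimpleGraph.fromRel fun u v => (u, v) ∈
    ([(0, 1), (0, 5), (0, 9), (1, 2), (1, 4), (1, 6), (1, 10), (1, 11), (1, 12), (1, 14), (1, 16),
      (2, 3), (2, 5), (3, 4), (3, 8), (3, 11), (4, 5), (5, 6), (5, 10), (5, 11), (5, 12), (5, 14),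
      (5, 16), (6, 7), (7, 8), (8, 9), (8, 13), (8, 15), (8, 17), (9, 10), (12, 13), (14, 15),
      (16, 17)] : List (Fin 18 × Fin 18))

/-!
Rigidity: a plane framework on a graph with `2 |V| - 3` edges that has no non-trivial
infinitesimal motion is rigid, because pinning the ends of an edge `ab` turns the edge-length map
into a local homeomorphism; by the inverse function theorem the length of any single edge can then
be changed while all others are kept, so deleting it yields a flexible framework. The absence of
non-trivial infinitesimal motions means that a Gram determinant, a polynomial in the coordinates
over `ℚ`, does not vanish, so it passes from one special realisation to all generic ones. It is
also inherited by gluing along `ab`: superimpose the copies of the special realisation.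

Counting: a colouring is a NAC-colouring or constant exactly when both of its colour classes are
flats of the cycle matroid, that is, when for each colour the vertices can be labelled so that the
edges of that colour are those with equal labels at their ends. Fixing the colour of `ab` makes
`ν + 1` the number of such colourings, and labellings of the copies agree on `a` and `b` after
renaming the labels, so `ν + 1` is multiplicative under gluing. In the base graph all vertices
other than `1, 3, 5, 8, 9` have only neighbours among these five, or form paths of two vertices
attached to them, so its colourings can be counted along the partitions of this core.
-/

section Plane

/-- The Euclidean plane. -/
abbrev Plane : Type := EuclideanSpace ℝ (Fin 2)

/-- The product of a complex number and a point of the plane, identified with `ℂ`. -/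
noncomputable def complexMul (z : ℂ) (x : Plane) : Plane :=
  Complex.orthonormalBasisOneI.repr (z * Complex.orthonormalBasisOneI.repr.symm x)

/-- The quotient of two points of the plane, identified with `ℂ`. -/
noncomputable def complexDiv (x y : Plane) : ℂ :=
  Complex.orthonormalBasisOneI.repr.symm x / Complex.orthonormalBasisOneI.repr.symm y

variable {z : ℂ} {x y : Plane}

lemma complexMul_zero_left (x : Plane) : complexMul 0 x = 0 := by
  rw [complexMul, zero_mul, map_zero]

lemma complexMul_one (x : Plane) : complexMul 1 x = x := by
  rw [complexMul, one_mul, LinearIsometryEquiv.apply_symm_apply]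

lemma complexMul_sub (z : ℂ) (x y : Plane) :
    complexMul z (x - y) = complexMul z x - complexMul z y := by
  simp only [complexMul, map_sub, mul_sub]

lemma norm_complexMul (z : ℂ) (x : Plane) : ‖complexMul z x‖ = ‖z‖ * ‖x‖ := by
  simp only [complexMul, LinearIsometryEquiv.norm_map, norm_mul]

lemma inner_complexMul (x : Plane) (z : ℂ) :
    inner ℝ x (complexMul z x) = z.re * ‖x‖ ^ 2 := by
  rw [← LinearIsometryEquiv.inner_map_map Complex.orthonormalBasisOneI.repr.symm, complexMul,
    LinearIsometryEquiv.symm_apply_apply, Complex.inner, mul_assoc, Complex.mul_conj,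
    ← Complex.sq_norm, LinearIsometryEquiv.norm_map, Complex.re_mul_ofReal]

lemma complexMul_complexDiv (x : Plane) (hy : y ≠ 0) : complexMul (complexDiv x y) y = x := by
  rw [complexMul, complexDiv, div_mul_cancel₀ _ (EmbeddingLike.map_ne_zero_iff.2 hy),
    LinearIsometryEquiv.apply_symm_apply]

lemma norm_complexDiv (x y : Plane) : ‖complexDiv x y‖ = ‖x‖ / ‖y‖ := by
  simp only [complexDiv, norm_div, LinearIsometryEquiv.norm_map]

lemma complexDiv_self (hx : x ≠ 0) : complexDiv x x = 1 :=
  div_self (EmbeddingLike.map_ne_zero_iff.2 hx)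

lemma inner_eq_zero_iff_exists_complexMul (hx : x ≠ 0) :
    inner ℝ x y = 0 ↔ ∃ s : ℝ, complexMul (s * Complex.I) x = y := by
  constructor
  · intro h
    rw [← complexMul_complexDiv y hx, inner_complexMul, mul_eq_zero_iff_right (by simpa using hx)]
      at h
    refine ⟨(complexDiv y x).im, ?_⟩
    rw [show ((complexDiv y x).im * Complex.I : ℂ) = complexDiv y x by
      simpa [h] using Complex.re_add_im (complexDiv y x), complexMul_complexDiv y hx]
  · rintro ⟨s, rfl⟩
    simp [inner_complexMul]

end Plane

section InfinitesimalRigidity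

variable {V : Type*} {G : SimpleGraph V}

/-- The velocities `q` do not change the lengths of the edges of `(G, p)` to first order. -/
def IsInfinitesimalMotion {d : ℕ} (G : SimpleGraph V) (p q : Realisation V d) : Prop :=
  ∀ ⦃u v⦄, G.Adj u v → inner ℝ (p u - p v) (q u - q v) = 0

/-- Every infinitesimal motion of the framework `(G, p)` in the plane is a combination of a
rotation about the origin and a translation. -/
def IsInfinitesimallyRigid (G : SimpleGraph V) (p : Realisation V 2) : Prop :=
  ∀ q, IsInfinitesimalMotion G p q → ∃ (s : ℝ) (τ : Plane),
    ∀ v, q v = complexMul (s * Complex.I) (p v) + τ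

lemma isInfinitesimallyRigid_iff_pinned {p : Realisation V 2} {a b : V} (hab : G.Adj a b)
    (hne : p a ≠ p b) : IsInfinitesimallyRigid G p ↔
      ∀ q, IsInfinitesimalMotion G p q → q a = 0 → q b = 0 → q = 0 := by
  have hd : p a - p b ≠ 0 := sub_ne_zero.2 hne
  constructor
  · intro h q hq ha hb
    obtain ⟨s, τ, hs⟩ := h q hq
    have hrot : complexMul (s * Complex.I) (p a - p b) = 0 := by
      rw [complexMul_sub, ← add_sub_add_right_eq_sub _ _ τ, ← hs, ← hs, ha, hb, sub_zero]
    have hs0 : s = 0 := by simpa [norm_complexMul, hd] using congrArg norm hrot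
    have hτ (v : V) : q v = τ := by
      rw [hs, hs0, Complex.ofReal_zero, zero_mul, complexMul_zero_left, zero_add]
    exact funext fun v => (hτ v).trans ((hτ a).symm.trans ha)
  · intro h q hq
    obtain ⟨s, hs⟩ := (inner_eq_zero_iff_exists_complexMul hd).1 (hq hab)
    refine ⟨s, q a - complexMul (s * Complex.I) (p a), fun v => ?_⟩
    have hr := h (fun v => q v - (complexMul (s * Complex.I) (p v) +
      (q a - complexMul (s * Complex.I) (p a)))) (fun u v huv => ?_) ?_ ?_
    · exact sub_eq_zero.1 (congrFun hr v)
    · rw [sub_sub_sub_comm, inner_sub_right, hq huv, add_sub_add_right_eq_sub, ← complexMul_sub,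
        inner_complexMul]
      simp
    · abel
    · rw [complexMul_sub, sub_eq_sub_iff_add_eq_add] at hs
      exact sub_eq_zero.2 (by rw [add_sub, eq_sub_iff_add_eq, add_comm, hs, add_comm])

end InfinitesimalRigidity

section Measurement

variable {V : Type*} {G : SimpleGraph V} {a b : V} {d : ℕ}

/-- The squared length of the pair `e` in the realisation `q`. -/
noncomputable def sqLength (q : Realisation V d) : Sym2 V → ℝ :=
  Sym2.lift ⟨fun u v => ‖q u - q v‖ ^ 2, fun _ _ => congrArg (· ^ 2) (norm_sub_rev _ _)⟩

lemma sqLength_eq_iff {p q : Realisation V d} {u v : V} :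
    sqLength p s(u, v) = sqLength q s(u, v) ↔ ‖p u - p v‖ = ‖q u - q v‖ :=
  pow_left_inj₀ (norm_nonneg _) (norm_nonneg _) two_ne_zero

/-- The edges of `G` other than `ab`. -/
abbrev UnpinnedEdge (G : SimpleGraph V) (a b : V) : Type _ :=
  (G.edgeSet \ {s(a, b)} : Set (Sym2 V))

/-- The squared lengths of the edges other than `ab`, and the positions of `a` and `b`. Fixing
the latter removes the trivial motions, up to finitely many, from the fibres of this map. -/
noncomputable def pinnedMeasurement (G : SimpleGraph V) (a b : V) (q : Realisation V d) :
    (UnpinnedEdge G a b → ℝ) × EuclideanSpace ℝ (Fin d) × EuclideanSpace ℝ (Fin d) :=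
  (fun e => sqLength q e, q a, q b)

lemma pinnedMeasurement_eq_iff {p q : Realisation V d} :
    pinnedMeasurement G a b q = pinnedMeasurement G a b p ↔
      RealisationEquivalent (G.deleteEdges {s(a, b)}) p q ∧ q a = p a ∧ q b = p b := by
  simp only [pinnedMeasurement, Prod.mk.injEq, funext_iff, Subtype.forall, Sym2.forall,
    sqLength_eq_iff, RealisationEquivalent]
  refine and_congr_left fun _ => forall₂_congr fun u v => ?_
  rw [SimpleGraph.deleteEdges_adj]
  exact forall_congr' fun _ => eq_comm

variable [Finite V]

lemma natCard_unpinnedEdge (hab : G.Adj a b) :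
    Nat.card (UnpinnedEdge G a b) + 1 = Nat.card G.edgeSet :=
  Set.ncard_sdiff_singleton_add_one (G.mem_edgeSet.2 hab)

lemma hasStrictFDerivAt_sqLength (p : Realisation V d) (u v : V) :
    HasStrictFDerivAt (fun q : Realisation V d => sqLength q s(u, v))
      (2 • (innerSL ℝ (p u - p v)).comp
        (ContinuousLinearMap.proj (R := ℝ) (φ := fun _ : V => EuclideanSpace ℝ (Fin d)) u -
          ContinuousLinearMap.proj v)) p :=
  have := Fintype.ofFinite V
  (hasStrictFDerivAt_norm_sq (p u - p v)).comp p
    (ContinuousLinearMap.proj (R := ℝ) (φ := fun _ : V => EuclideanSpace ℝ (Fin d)) u -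
      ContinuousLinearMap.proj v).hasStrictFDerivAt

lemma hasStrictFDerivAt_fderiv_sqLength (p : Realisation V d) (e : Sym2 V) :
    HasStrictFDerivAt (fun q : Realisation V d => sqLength q e)
      (fderiv ℝ (fun q : Realisation V d => sqLength q e) p) p := by
  induction e with | _ u v
  exact (hasStrictFDerivAt_sqLength p u v).hasFDerivAt.fderiv ▸ hasStrictFDerivAt_sqLength p u v

/-- The derivative of `pinnedMeasurement`. -/
noncomputable def pinnedDeriv (G : SimpleGraph V) (a b : V) (p : Realisation V d) :
    Realisation V d →L[ℝ]
      (UnpinnedEdge G a b → ℝ) × EuclideanSpace ℝ (Fin d) × EuclideanSpace ℝ (Fin d) :=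
  (ContinuousLinearMap.pi fun e : UnpinnedEdge G a b =>
    fderiv ℝ (fun q : Realisation V d => sqLength q e) p).prod
    ((ContinuousLinearMap.proj a).prod (ContinuousLinearMap.proj b))

lemma hasStrictFDerivAt_pinnedMeasurement (G : SimpleGraph V) (a b : V) (p : Realisation V d) :
    HasStrictFDerivAt (pinnedMeasurement G a b) (pinnedDeriv G a b p) p := by
  have := Fintype.ofFinite V
  have := Fintype.ofFinite (UnpinnedEdge G a b)
  exact HasStrictFDerivAt.prodMk
    (hasStrictFDerivAt_pi.2 fun e => hasStrictFDerivAt_fderiv_sqLength p e)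
    (HasStrictFDerivAt.prodMk (hasStrictFDerivAt_apply a p) (hasStrictFDerivAt_apply b p))

lemma isInfinitesimalMotion_of_pinnedDeriv_eq_zero {p q : Realisation V d}
    (hq : pinnedDeriv G a b p q = 0) : IsInfinitesimalMotion G p q ∧ q a = 0 ∧ q b = 0 := by
  obtain ⟨hedge, ha, hb⟩ : _ ∧ q a = 0 ∧ q b = 0 := by simpa [pinnedDeriv] using hq
  refine ⟨fun u v huv => ?_, ha, hb⟩
  by_cases hne : s(u, v) = s(a, b)
  · rcases Sym2.eq_iff.1 hne with ⟨rfl, rfl⟩ | ⟨rfl, rfl⟩ <;> simp [ha, hb]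
  · have h : fderiv ℝ (fun q : Realisation V d => sqLength q s(u, v)) p q = 0 :=
      congrFun hedge ⟨s(u, v), G.mem_edgeSet.2 huv, hne⟩
    rw [(hasStrictFDerivAt_sqLength p u v).hasFDerivAt.fderiv] at h
    simpa [-map_sub, inner_sub_right] using h

lemma pinnedDeriv_injective {p : Realisation V 2} (hab : G.Adj a b)
    (hne : p a ≠ p b) (hp : IsInfinitesimallyRigid G p) :
    Function.Injective (pinnedDeriv G a b p) := by
  refine (injective_iff_map_eq_zero _).2 fun q hq => ?_
  obtain ⟨h, ha, hb⟩ := isInfinitesimalMotion_of_pinnedDeriv_eq_zero hq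
  exact (isInfinitesimallyRigid_iff_pinned hab hne).1 hp q h ha hb

end Measurement

section Rigid

lemma eq_of_eventually_notMem_range {X Y : Type*} [TopologicalSpace X] [PreconnectedSpace X]
    [TopologicalSpace Y] [T1Space Y] {f : X → Y} (hf : Continuous f) (x₀ : X)
    (h : ∀ᶠ y in nhdsWithin (f x₀) {f x₀}ᶜ, y ∉ Set.range f) (x : X) : f x = f x₀ := by
  have hopen : IsOpen (f ⁻¹' {f x₀}) := by
    refine isOpen_iff_mem_nhds.2 fun t (ht : f t = f x₀) => ?_
    rw [← ht] at h ⊢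
    filter_upwards [hf.continuousAt (eventually_nhdsWithin_iff.1 h)] with u hu
    exact by_contra fun hne => hu hne ⟨u, rfl⟩
  have huniv : f ⁻¹' {f x₀} = Set.univ :=
    IsClopen.eq_univ ⟨isClosed_singleton.preimage hf, hopen⟩ ⟨x₀, rfl⟩
  exact Set.eq_univ_iff_forall.1 huniv x

variable {V : Type*} {G : SimpleGraph V} {a b : V}

/-- The image of `q` under the similarity that moves `a` and `b` to their positions in `p`. -/
noncomputable def alignTo (p : Realisation V 2) (a b : V) (q : Realisation V 2) :
    Realisation V 2 :=
  fun v => p a + complexMul (complexDiv (p b - p a) (q b - q a)) (q v - q a)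

section Alignment

variable {p q : Realisation V 2}

lemma alignTo_left (p q : Realisation V 2) (a b : V) : alignTo p a b q a = p a := by
  simp [alignTo, complexMul]

lemma alignTo_right (hq : q b ≠ q a) : alignTo p a b q b = p b := by
  rw [alignTo, complexMul_complexDiv _ (sub_ne_zero.2 hq), add_sub_cancel]

lemma alignTo_self (hp : p b ≠ p a) : alignTo p a b p = p := by
  funext v
  rw [alignTo, complexDiv_self (sub_ne_zero.2 hp), complexMul_one, add_sub_cancel]

lemma realisationCongruent_alignTo (hq : q b ≠ q a) (h : ‖p b - p a‖ = ‖q b - q a‖) :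
    RealisationCongruent (alignTo p a b q) q := by
  intro u v
  rw [alignTo, alignTo, add_sub_add_left_eq_sub, ← complexMul_sub, norm_complexMul,
    norm_complexDiv, h, div_self (norm_ne_zero_iff.2 (sub_ne_zero.2 hq)), one_mul,
    sub_sub_sub_cancel_right]

lemma continuousOn_alignTo (p : Realisation V 2) (a b : V) :
    ContinuousOn (alignTo p a b) {q | q b ≠ q a} := by
  refine continuousOn_pi.2 fun v => ?_
  simp only [alignTo, complexMul, complexDiv]
  have hdiv : ContinuousOn (fun q : Realisation V 2 =>
      Complex.orthonormalBasisOneI.repr.symm (p b - p a) /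
        Complex.orthonormalBasisOneI.repr.symm (q b - q a)) {q | q b ≠ q a} :=
    ContinuousOn.div (by fun_prop) (by fun_prop) fun q hq =>
      EmbeddingLike.map_ne_zero_iff.2 (sub_ne_zero.2 hq)
  fun_prop

end Alignment

variable [Finite V]

lemma eventually_pinnedMeasurement_ne {p : Realisation V 2} (hab : G.Adj a b) (hne : p a ≠ p b)
    (hp : IsInfinitesimallyRigid G p) :
    ∀ᶠ q in nhdsWithin p {p}ᶜ, pinnedMeasurement G a b q ≠ pinnedMeasurement G a b p := by
  have := Fintype.ofFinite V
  have := Fintype.ofFinite (UnpinnedEdge G a b)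
  obtain ⟨C, -, hC⟩ := (pinnedDeriv G a b p).exists_antilipschitzWith
    (LinearMap.ker_eq_bot.2 (pinnedDeriv_injective hab hne hp))
  exact (hasStrictFDerivAt_pinnedMeasurement G a b p).hasFDerivAt.eventually_ne ⟨C, hC⟩

theorem IsInfinitesimallyRigid.rigidFramework {p : Realisation V 2} (hab : G.Adj a b)
    (hne : p a ≠ p b) (hp : IsInfinitesimallyRigid G p) : RigidFramework G p := by
  rintro ⟨φ, ⟨hcont, h0, hmot⟩, hnon⟩
  have hφ (t : Set.Ioo (-1 : ℝ) 1) : ‖p b - p a‖ = ‖φ t b - φ t a‖ := hmot t t.2 _ _ hab.symm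
  have hφne (t : Set.Ioo (-1 : ℝ) 1) : φ t b ≠ φ t a :=
    sub_ne_zero.1 (norm_ne_zero_iff.1 (hφ t ▸ norm_ne_zero_iff.2 (sub_ne_zero.2 hne.symm)))
  let ψ (t : Set.Ioo (-1 : ℝ) 1) : Realisation V 2 := alignTo p a b (φ t)
  have hψcong (t) : RealisationCongruent (ψ t) (φ t) :=
    realisationCongruent_alignTo (hφne t) (hφ t)
  have hψcont : Continuous ψ := (continuousOn_alignTo p a b).comp_continuous
    (continuous_pi fun v => continuousOn_iff_continuous_domRestrict.1 (hcont v)) hφne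
  have hψmeas (t) : pinnedMeasurement G a b (ψ t) = pinnedMeasurement G a b p :=
    pinnedMeasurement_eq_iff.2
      ⟨fun u v huv => (hmot t t.2 u v (G.deleteEdges_le _ huv)).trans (hψcong t u v).symm,
        alignTo_left .., alignTo_right (hφne t)⟩
  have hψ0 : ψ ⟨0, by norm_num⟩ = p := by simp only [ψ, h0, alignTo_self hne.symm]
  have : PreconnectedSpace (Set.Ioo (-1 : ℝ) 1) := Subtype.preconnectedSpace isPreconnected_Ioo
  have hψ (t) : ψ t = p := by
    refine (eq_of_eventually_notMem_range hψcont ⟨0, by norm_num⟩ ?_ t).trans hψ0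
    rw [hψ0]
    filter_upwards [eventually_pinnedMeasurement_ne hab hne hp] with q hq
    rintro ⟨t, rfl⟩
    exact hq (hψmeas t)
  exact hnon fun t ht => by simpa only [hψ] using hψcong ⟨t, ht⟩

end Rigid

section Flexible

lemma exists_lift_segment_of_hasStrictFDerivAt {E F : Type*} [NormedAddCommGroup E]
    [NormedSpace ℝ E] [CompleteSpace E] [NormedAddCommGroup F] [NormedSpace ℝ F] {f : E → F}
    {f' : E ≃L[ℝ] F} {x : E} (hf : HasStrictFDerivAt f (f' : E →L[ℝ] F) x) (w : F) :
    ∃ ε > 0, ∃ φ : ℝ → E, ContinuousOn φ (Set.Ioo (-1) 1) ∧ φ 0 = x ∧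
      ∀ t ∈ Set.Ioo (-1 : ℝ) 1, f (φ t) = f x + (t * ε) • w := by
  let Φ := hf.toOpenPartialHomeomorph f
  have hx : x ∈ Φ.source := hf.mem_toOpenPartialHomeomorph_source
  have hcont : Continuous fun r : ℝ => Φ x + r • w := by fun_prop
  have hnhds : (fun r : ℝ => Φ x + r • w) ⁻¹' Φ.target ∈ nhds 0 :=
    hcont.continuousAt.preimage_mem_nhds (Φ.open_target.mem_nhds (by simpa using Φ.map_source hx))
  obtain ⟨ε, hε, hball⟩ := Metric.mem_nhds_iff.1 hnhds
  have hmem (t) (ht : t ∈ Set.Ioo (-1 : ℝ) 1) : Φ x + (t * ε) • w ∈ Φ.target := by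
    refine hball (a := t * ε) ?_
    rw [mem_ball_zero_iff, Real.norm_eq_abs, abs_mul, abs_of_pos hε]
    exact mul_lt_of_lt_one_left hε (abs_lt.2 ht)
  refine ⟨ε, hε, fun t => Φ.symm (Φ x + (t * ε) • w),
    Φ.continuousOn_symm.comp (by fun_prop) hmem, by simp [hx], fun t ht => Φ.right_inv (hmem t ht)⟩

variable {V : Type*} [Finite V] {G : SimpleGraph V} {a b : V} {p : Realisation V 2}

lemma exists_pinnedMeasurement_curve (hcard : Nat.card G.edgeSet + 3 = 2 * Nat.card V)
    (hab : G.Adj a b) (hne : p a ≠ p b) (hp : IsInfinitesimallyRigid G p)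
    (w : (UnpinnedEdge G a b → ℝ) × Plane × Plane) :
    ∃ ε > 0, ∃ φ : ℝ → Realisation V 2, ContinuousOn φ (Set.Ioo (-1) 1) ∧ φ 0 = p ∧
      ∀ t ∈ Set.Ioo (-1 : ℝ) 1,
        pinnedMeasurement G a b (φ t) = pinnedMeasurement G a b p + (t * ε) • w := by
  have := Fintype.ofFinite V
  have := Fintype.ofFinite (UnpinnedEdge G a b)
  have hfin : Module.finrank ℝ (Realisation V 2) =
      Module.finrank ℝ ((UnpinnedEdge G a b → ℝ) × Plane × Plane) := by
    have hedge := natCard_unpinnedEdge hab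
    simp only [Module.finrank_prod, Module.finrank_pi, Module.finrank_pi_fintype,
      finrank_euclideanSpace_fin, Finset.sum_const, Finset.card_univ, smul_eq_mul,
      ← Nat.card_eq_fintype_card]
    omega
  let L := (LinearEquiv.ofInjectiveOfFinrankEq (pinnedDeriv G a b p).toLinearMap
    (pinnedDeriv_injective hab hne hp) hfin).toContinuousLinearEquiv
  exact exists_lift_segment_of_hasStrictFDerivAt (f' := L)
    (hasStrictFDerivAt_pinnedMeasurement G a b p) w

/-- The other edges and the position of `a` are kept while `b` moves away from `a`. -/
theorem IsInfinitesimallyRigid.flexibleFramework_deleteEdges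
    (hcard : Nat.card G.edgeSet + 3 = 2 * Nat.card V) (hab : G.Adj a b) (hne : p a ≠ p b)
    (hp : IsInfinitesimallyRigid G p) : FlexibleFramework (G.deleteEdges {s(a, b)}) p := by
  obtain ⟨ε, hε, φ, hcont, h0, hφ⟩ := exists_pinnedMeasurement_curve hcard hab hne hp
    (0, 0, p b - p a)
  have ha (t) (ht : t ∈ Set.Ioo (-1 : ℝ) 1) : φ t a = p a := by
    simpa [pinnedMeasurement] using congrArg (·.2.1) (hφ t ht)
  have hb (t) (ht : t ∈ Set.Ioo (-1 : ℝ) 1) : φ t b = p b + (t * ε) • (p b - p a) :=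
    congrArg (·.2.2) (hφ t ht)
  refine ⟨φ, ⟨fun v => (continuous_apply v).comp_continuousOn hcont, h0, fun t ht u v huv => ?_⟩,
    fun htriv => ?_⟩
  · rw [SimpleGraph.deleteEdges_adj] at huv
    have h := congrFun (congrArg Prod.fst (hφ t ht)) ⟨s(u, v), huv⟩
    exact (sqLength_eq_iff.1 (by simpa [pinnedMeasurement] using h)).symm
  · have ht : (1 / 2 : ℝ) ∈ Set.Ioo (-1 : ℝ) 1 := by norm_num
    have hd : 0 < ‖p b - p a‖ := norm_pos_iff.2 (sub_ne_zero.2 hne.symm)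
    have hdist : ‖φ (1 / 2) b - φ (1 / 2) a‖ = (1 + 1 / 2 * ε) * ‖p b - p a‖ := by
      rw [ha _ ht, hb _ ht, ← abs_of_pos (show 0 < 1 + 1 / 2 * ε by positivity),
        ← Real.norm_eq_abs, ← norm_smul]
      congr 1
      module
    have hgrow : ‖p b - p a‖ < (1 + 1 / 2 * ε) * ‖p b - p a‖ :=
      lt_mul_of_one_lt_left hd (by linarith)
    exact hgrow.ne ((htriv _ ht b a).trans hdist)

end Flexible

section Generic

lemma mulVec_injective_iff_det_ne_zero {m n : Type*} [Fintype m] [Fintype n] [DecidableEq n]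
    {A : Matrix m n ℝ} :
    Function.Injective A.mulVec ↔ (A.transpose * A).det ≠ 0 := by
  rw [Ne, ← Matrix.exists_mulVec_eq_zero_iff, ← Matrix.conjTranspose_eq_transpose_of_trivial]
  simp only [Matrix.conjTranspose_mul_self_mulVec_eq_zero]
  rw [← Matrix.coe_mulVecLin, injective_iff_map_eq_zero]
  simp only [Matrix.mulVecLin_apply]
  grind

lemma mulVec_map_aeval_injective_of_algebraicIndependent {m n σ : Type*} [Finite m] [Fintype n]
    {M : Matrix m n (MvPolynomial σ ℚ)} {x y : σ → ℝ}
    (hx : Function.Injective (M.map (MvPolynomial.aeval x)).mulVec)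
    (hy : AlgebraicIndependent ℚ y) :
    Function.Injective (M.map (MvPolynomial.aeval y)).mulVec := by
  classical
  have := Fintype.ofFinite m
  have heval (z : σ → ℝ) : ((M.map (MvPolynomial.aeval z)).transpose *
      M.map (MvPolynomial.aeval z)).det = MvPolynomial.aeval z (M.transpose * M).det := by
    rw [← Matrix.transpose_map, ← Matrix.map_mul, ← AlgHom.mapMatrix_apply, ← AlgHom.map_det]
  rw [mulVec_injective_iff_det_ne_zero, heval] at hx ⊢
  intro h
  rw [algebraicIndependent_iff.1 hy _ h, map_zero] at hx
  exact hx rfl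

variable {V : Type*} [DecidableEq V] {A : Type*} [CommRing A] {G : SimpleGraph V} {a b : V}

/-- The rigidity matrix of the plane framework with coordinates `p`, with one row for each
orientation of an edge, followed by rows that pin the vertices `a` and `b`. -/
def pinnedMatrix (G : SimpleGraph V) (a b : V) (p : V × Fin 2 → A) :
    Matrix (G.Dart ⊕ (Fin 2 × Fin 2)) (V × Fin 2) A
  | Sum.inl e, x => (p (e.fst, x.2) - p (e.snd, x.2)) *
      ((if x.1 = e.fst then 1 else 0) - if x.1 = e.snd then 1 else 0)
  | Sum.inr s, x => if x = (![a, b] s.1, s.2) then 1 else 0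

lemma pinnedMatrix_map {B F : Type*} [CommRing B] [FunLike F A B] [RingHomClass F A B] (f : F)
    (p : V × Fin 2 → A) : (pinnedMatrix G a b p).map f = pinnedMatrix G a b (f ∘ p) := by
  ext (e | s) x <;> simp [pinnedMatrix, apply_ite f]

variable [Fintype V]

lemma pinnedMatrix_mulVec_inl (p q : V × Fin 2 → A) (e : G.Dart) :
    (pinnedMatrix G a b p).mulVec q (Sum.inl e) =
      ∑ i, (p (e.fst, i) - p (e.snd, i)) * (q (e.fst, i) - q (e.snd, i)) := by
  simp [Matrix.mulVec, dotProduct, pinnedMatrix, Fintype.sum_prod_type_right, mul_sub, sub_mul,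
    Finset.sum_sub_distrib]

lemma pinnedMatrix_mulVec_inr (p q : V × Fin 2 → A) (s : Fin 2 × Fin 2) :
    (pinnedMatrix G a b p).mulVec q (Sum.inr s) = q (![a, b] s.1, s.2) := by
  simp [Matrix.mulVec, dotProduct, pinnedMatrix]

lemma pinnedMatrix_mulVec_eq_zero_iff {p q : Realisation V 2} :
    (pinnedMatrix G a b fun x => p x.1 x.2).mulVec (fun x => q x.1 x.2) = 0 ↔
      IsInfinitesimalMotion G p q ∧ q a = 0 ∧ q b = 0 := by
  have hinner (e : G.Dart) : (pinnedMatrix G a b fun x => p x.1 x.2).mulVec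
      (fun x => q x.1 x.2) (Sum.inl e) = inner ℝ (p e.fst - p e.snd) (q e.fst - q e.snd) := by
    rw [pinnedMatrix_mulVec_inl, PiLp.inner_apply]
    simp [mul_comm]
  rw [funext_iff, Sum.forall]
  refine and_congr ?_ ?_
  · simp only [hinner]
    exact ⟨fun h u v huv => h ⟨(u, v), huv⟩, fun h e => h e.adj⟩
  · simp [pinnedMatrix_mulVec_inr, Prod.forall, Fin.forall_fin_two, PiLp.ext_iff]

lemma isInfinitesimallyRigid_iff_mulVec_injective {p : Realisation V 2} (hab : G.Adj a b)
    (hne : p a ≠ p b) : IsInfinitesimallyRigid G p ↔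
      Function.Injective (pinnedMatrix G a b fun x => p x.1 x.2).mulVec := by
  rw [isInfinitesimallyRigid_iff_pinned hab hne, ← Matrix.coe_mulVecLin, injective_iff_map_eq_zero]
  simp only [Matrix.mulVecLin_apply]
  constructor
  · intro h q hq
    let q' : Realisation V 2 := fun v => WithLp.toLp 2 fun i => q (v, i)
    obtain ⟨hmot, ha, hb⟩ := pinnedMatrix_mulVec_eq_zero_iff (q := q').1 hq
    exact funext fun x => congrArg (fun r : Realisation V 2 => r x.1 x.2) (h q' hmot ha hb)
  · intro h q hmot ha hb
    have hq := h _ (pinnedMatrix_mulVec_eq_zero_iff.2 ⟨hmot, ha, hb⟩)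
    exact funext fun v => PiLp.ext fun i => congrFun hq (v, i)

end Generic

section MinimalRigidity

variable {V : Type*} {G : SimpleGraph V} {a b : V} {p₀ p : Realisation V 2}

lemma GenericRealisation.injective {d : ℕ} [NeZero d] {p : Realisation V d}
    (hp : GenericRealisation p) : Function.Injective p := by
  intro u v h
  have heq : (u, (0 : Fin d)) = (v, 0) := AlgebraicIndependent.injective hp (by simp only [h])
  exact congrArg Prod.fst heq

variable [Finite V]

theorem IsInfinitesimallyRigid.of_generic (hab : G.Adj a b) (hne : p₀ a ≠ p₀ b)
    (h : IsInfinitesimallyRigid G p₀) (hp : GenericRealisation p) :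
    IsInfinitesimallyRigid G p := by
  classical
  have := Fintype.ofFinite V
  have hM (r : Realisation V 2) : (pinnedMatrix G a b fun x => r x.1 x.2) =
      (pinnedMatrix G a b MvPolynomial.X).map
        (MvPolynomial.aeval (R := ℚ) fun x : V × Fin 2 => r x.1 x.2) := by
    rw [pinnedMatrix_map]
    refine congrArg _ (funext fun x => ?_)
    rw [Function.comp_apply, MvPolynomial.aeval_X]
  rw [isInfinitesimallyRigid_iff_mulVec_injective hab hne, hM] at h
  rw [isInfinitesimallyRigid_iff_mulVec_injective hab (hp.injective.ne hab.ne), hM]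
  exact mulVec_map_aeval_injective_of_algebraicIndependent h hp

theorem isMinimallyRigid_of_isInfinitesimallyRigid
    (hcard : Nat.card G.edgeSet + 3 = 2 * Nat.card V) (hab : G.Adj a b) (hne : p₀ a ≠ p₀ b)
    (h : IsInfinitesimallyRigid G p₀) : IsMinimallyRigid G := by
  refine ⟨fun p hp => ?_, fun e he p hp => ?_⟩
  · exact (h.of_generic hab hne hp).rigidFramework hab (hp.injective.ne hab.ne)
  · induction e with | _ u v
    exact (h.of_generic hab hne hp).flexibleFramework_deleteEdges hcard he
      (hp.injective.ne (G.ne_of_adj he))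

end MinimalRigidity

section Gluing

variable {V : Type*} {H : SimpleGraph V} {a b : V} {k : ℕ}

lemma card_glueVertex [Finite V] (hab : a ≠ b) :
    Nat.card (GlueVertex a b k) = k * (Nat.card V - 2) + 2 := by
  have hcard : Nat.card {x : V // x ≠ a ∧ x ≠ b} = Nat.card V - 2 := by
    rw [← Set.ncard_pair hab, ← Set.ncard_compl]
    exact Nat.card_congr (Equiv.subtypeEquivRight fun x => by simp)
  rw [Nat.card_sum, Nat.card_prod, Nat.card_fin, Nat.card_fin, hcard, add_comm]

variable [DecidableEq V]

lemma glueInclusion_left (i : Fin k) : glueInclusion a b k i a = Sum.inl 0 :=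
  dif_pos rfl

lemma glueInclusion_right (hab : a ≠ b) (i : Fin k) : glueInclusion a b k i b = Sum.inl 1 := by
  rw [glueInclusion, dif_neg hab.symm, dif_pos rfl]

lemma glueInclusion_of_ne (i : Fin k) (v : {x : V // x ≠ a ∧ x ≠ b}) :
    glueInclusion a b k i v = Sum.inr (i, v) := by
  rw [glueInclusion, dif_neg v.2.1, dif_neg v.2.2]

/-- The map on the glued vertices that sends the two common vertices to `x` and `y` and is `f i`
on the `i`-th copy. -/
def glueLift {α : Type*} (x y : α) (f : Fin k → V → α) : GlueVertex a b k → α :=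
  Sum.elim ![x, y] fun z => f z.1 z.2

lemma glueLift_glueInclusion (hab : a ≠ b) {α : Type*} {x y : α} {f : Fin k → V → α}
    (hx : ∀ i, f i a = x) (hy : ∀ i, f i b = y) (i : Fin k) (v : V) :
    glueLift x y f (glueInclusion a b k i v) = f i v := by
  by_cases ha : v = a
  · rw [ha, glueInclusion_left, hx]; rfl
  by_cases hb : v = b
  · rw [hb, glueInclusion_right hab, hy]; rfl
  · rw [glueInclusion_of_ne i ⟨v, ha, hb⟩]; rfl

/-- The map that superimposes the copies. -/
def glueFold (a b : V) (k : ℕ) : GlueVertex a b k → V :=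
  glueLift a b fun _ => id

lemma glueFold_glueInclusion (hab : a ≠ b) (i : Fin k) (v : V) :
    glueFold a b k (glueInclusion a b k i v) = v :=
  glueLift_glueInclusion hab (f := fun _ => id) (fun _ => rfl) (fun _ => rfl) i v

lemma glueInclusion_injective (i : Fin k) : Function.Injective (glueInclusion a b k i) := by
  intro u v h
  unfold glueInclusion at h
  split_ifs at h <;> simp_all

lemma exists_glueInclusion_eq (hab : a ≠ b) (i₀ : Fin k) (x : GlueVertex a b k) :
    ∃ i v, glueInclusion a b k i v = x := by
  rcases x with x | ⟨i, v⟩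
  · fin_cases x
    exacts [⟨i₀, a, glueInclusion_left i₀⟩, ⟨i₀, b, glueInclusion_right hab i₀⟩]
  · exact ⟨i, v, glueInclusion_of_ne i v⟩

lemma glueInclusion_eq_glueInclusion_iff (hab : a ≠ b) {i j : Fin k} {u v : V} :
    glueInclusion a b k i u = glueInclusion a b k j v ↔ u = v ∧ (i = j ∨ u = a ∨ u = b) := by
  constructor
  · intro h
    have huv : u = v := by
      simpa only [glueFold_glueInclusion hab] using congrArg (glueFold a b k) h
    refine ⟨huv, ?_⟩
    by_contra! hne
    rw [← huv, glueInclusion_of_ne i ⟨u, hne.2⟩, glueInclusion_of_ne j ⟨u, hne.2⟩] at h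
    exact hne.1 (congrArg Prod.fst (Sum.inr_injective h))
  · rintro ⟨rfl, rfl | rfl | rfl⟩
    · rfl
    · rw [glueInclusion_left, glueInclusion_left]
    · rw [glueInclusion_right hab, glueInclusion_right hab]

/-- The inclusion of the `i`-th copy as a graph homomorphism. -/
def glueHom (H : SimpleGraph V) (a b : V) (k : ℕ) (i : Fin k) : H →g glueCopies H a b k where
  toFun := glueInclusion a b k i
  map_rel' h := SimpleGraph.iSup_adj.2
    ⟨i, SimpleGraph.map_adj_apply' h ((glueInclusion_injective i).ne h.ne)⟩

lemma exists_mapEdgeSet_glueHom_eq (e : (glueCopies H a b k).edgeSet) :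
    ∃ i f, (glueHom H a b k i).mapEdgeSet f = e := by
  obtain ⟨⟨x, y⟩, h⟩ := e
  obtain ⟨i, -, u, v, huv, rfl, rfl⟩ := SimpleGraph.iSup_adj.1 h
  exact ⟨i, ⟨s(u, v), huv⟩, rfl⟩

lemma mapEdgeSet_glueHom_eq_iff (hab : a ≠ b) {i j : Fin k} {e f : H.edgeSet} :
    (glueHom H a b k i).mapEdgeSet e = (glueHom H a b k j).mapEdgeSet f ↔
      e = f ∧ (i = j ∨ (e : Sym2 V) = s(a, b)) := by
  have hval (i : Fin k) (e : H.edgeSet) : ((glueHom H a b k i).mapEdgeSet e : Sym2 _) =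
      Sym2.map (glueInclusion a b k i) e := rfl
  rw [Subtype.ext_iff, hval, hval]
  constructor
  · intro h
    have hef : e = f := by
      have := congrArg (Sym2.map (glueFold a b k)) h
      simpa only [Sym2.map_map, Function.comp_def, glueFold_glueInclusion hab, Sym2.map_id',
        id_eq, ← Subtype.ext_iff] using this
    subst hef
    obtain ⟨⟨u, v⟩, huv⟩ := e
    have hne : u ≠ v := H.ne_of_adj huv
    simp only [Sym2.map_mk, Sym2.eq_iff, glueInclusion_eq_glueInclusion_iff hab] at h ⊢
    grind
  · rintro ⟨rfl, rfl | he⟩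
    · rfl
    · simp only [he, Sym2.map_mk, glueInclusion_left, glueInclusion_right hab]

lemma card_edgeSet_glueCopies [Finite V] (hab : H.Adj a b) (i₀ : Fin k) :
    Nat.card (glueCopies H a b k).edgeSet = k * (Nat.card H.edgeSet - 1) + 1 := by
  let e₀ : H.edgeSet := ⟨s(a, b), hab⟩
  let φ : Option (Fin k × {e : H.edgeSet // e ≠ e₀}) → (glueCopies H a b k).edgeSet := fun x =>
    x.elim ((glueHom H a b k i₀).mapEdgeSet e₀) fun x => (glueHom H a b k x.1).mapEdgeSet x.2
  have hφ : φ.Bijective := by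
    constructor
    · rintro (_ | ⟨i, e, he⟩) (_ | ⟨j, f, hf⟩) h
      · rfl
      · exact absurd ((mapEdgeSet_glueHom_eq_iff hab.ne).1 h).1.symm hf
      · exact absurd ((mapEdgeSet_glueHom_eq_iff hab.ne).1 h).1 he
      · obtain ⟨rfl, rfl | h⟩ := (mapEdgeSet_glueHom_eq_iff hab.ne).1 h
        · rfl
        · exact absurd (Subtype.ext h) he
    · intro e
      obtain ⟨i, f, rfl⟩ := exists_mapEdgeSet_glueHom_eq e
      by_cases hf : f = e₀
      · exact ⟨none, (mapEdgeSet_glueHom_eq_iff hab.ne).2 ⟨hf.symm, .inr rfl⟩⟩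
      · exact ⟨some (i, ⟨f, hf⟩), rfl⟩
  rw [← Nat.card_eq_of_bijective φ hφ, Finite.card_option, Nat.card_prod, Nat.card_fin]
  congr 2
  exact (Set.ncard_compl {e₀}).trans (by rw [Set.ncard_singleton])

end Gluing

section RigidGluing

variable {V W : Type*} {G : SimpleGraph V} {H : SimpleGraph W}

lemma IsInfinitesimalMotion.comp_hom {d : ℕ} {p q : Realisation W d}
    (h : IsInfinitesimalMotion H p q) (f : G →g H) : IsInfinitesimalMotion G (p ∘ f) (q ∘ f) :=
  fun _ _ huv => h (f.map_adj huv)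

variable [DecidableEq V] {a b : V} {p : Realisation V 2} {k : ℕ}

lemma isInfinitesimallyRigid_glueCopies (hab : G.Adj a b) (hne : p a ≠ p b)
    (h : IsInfinitesimallyRigid G p) (i₀ : Fin k) :
    IsInfinitesimallyRigid (glueCopies G a b k) (p ∘ glueFold a b k) := by
  have hfold (i : Fin k) : (p ∘ glueFold a b k) ∘ glueHom G a b k i = p :=
    funext fun v => congrArg p (glueFold_glueInclusion hab.ne i v)
  have hne₀ : (p ∘ glueFold a b k) (glueHom G a b k i₀ a) ≠
      (p ∘ glueFold a b k) (glueHom G a b k i₀ b) := by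
    simpa only [← Function.comp_apply (g := glueHom G a b k i₀), hfold] using hne
  rw [isInfinitesimallyRigid_iff_pinned ((glueHom G a b k i₀).map_adj hab) hne₀]
  intro q hq ha hb
  funext x
  obtain ⟨i, v, rfl⟩ := exists_glueInclusion_eq hab.ne i₀ x
  have hleft (i : Fin k) : glueHom G a b k i₀ a = glueHom G a b k i a :=
    (glueInclusion_left i₀).trans (glueInclusion_left i).symm
  have hright (i : Fin k) : glueHom G a b k i₀ b = glueHom G a b k i b :=
    (glueInclusion_right hab.ne i₀).trans (glueInclusion_right hab.ne i).symm
  have hcopy := (isInfinitesimallyRigid_iff_pinned hab hne).1 h (q ∘ glueHom G a b k i)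
    (hfold i ▸ hq.comp_hom (glueHom G a b k i)) (by rwa [hleft i] at ha) (by rwa [hright i] at hb)
  exact congrFun hcopy v

theorem isMinimallyRigid_glueCopies [Finite V] (hcard : Nat.card G.edgeSet + 3 = 2 * Nat.card V)
    (hab : G.Adj a b) (hne : p a ≠ p b) (h : IsInfinitesimallyRigid G p) (i₀ : Fin k) :
    IsMinimallyRigid (glueCopies G a b k) := by
  have hfold (v : V) : (p ∘ glueFold a b k) (glueHom G a b k i₀ v) = p v :=
    congrArg p (glueFold_glueInclusion hab.ne i₀ v)
  refine isMinimallyRigid_of_isInfinitesimallyRigid ?_ ((glueHom G a b k i₀).map_adj hab)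
    (by rwa [hfold, hfold]) (isInfinitesimallyRigid_glueCopies hab hne h i₀)
  have hverts : 1 < Nat.card V := Finite.one_lt_card_iff_nontrivial.2 ⟨a, b, hab.ne⟩
  rw [card_edgeSet_glueCopies hab i₀, card_glueVertex hab.ne]
  obtain ⟨n, hn⟩ := Nat.exists_eq_add_of_le hverts
  rw [hn, show Nat.card G.edgeSet = 2 * n + 1 by lia]
  simp only [add_tsub_cancel_left, add_tsub_cancel_right]
  ring

end RigidGluing

section NACColouring

variable {V : Type*} {G : SimpleGraph V} {c : G.edgeSet → Bool} {b : Bool}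

/-- The spanning subgraph formed by the edges of colour `b`. -/
def colourGraph (c : G.edgeSet → Bool) (b : Bool) : SimpleGraph V where
  Adj u v := ∃ h : G.Adj u v, c ⟨s(u, v), h⟩ = b
  symm := ⟨fun u v ⟨h, hc⟩ => ⟨h.symm, by simpa only [Sym2.eq_swap] using hc⟩⟩
  loopless := ⟨fun _ ⟨h, _⟩ => h.ne rfl⟩

/-- The edges of colour `b` form a flat of the cycle matroid of `G`. -/
def IsFlat (c : G.edgeSet → Bool) (b : Bool) : Prop :=
  ∀ ⦃u v⦄ (h : G.Adj u v), (colourGraph c b).Reachable u v → c ⟨s(u, v), h⟩ = b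

lemma colourGraph_le (c : G.edgeSet → Bool) (b : Bool) : colourGraph c b ≤ G :=
  fun _ _ h => h.1

lemma mem_edgeSet_colourGraph {e : Sym2 V} :
    e ∈ (colourGraph c b).edgeSet ↔ ∃ h : e ∈ G.edgeSet, c ⟨e, h⟩ = b :=
  e.ind fun _ _ => Iff.rfl

lemma IsNACColouring.isFlat (hc : IsNACColouring G c) (b : Bool) : IsFlat c b := by
  classical
  intro u v h hreach
  by_contra hne
  obtain ⟨P, hP⟩ := hreach.symm.exists_isPath
  have hedge (e : Sym2 V) (he : e ∈ (P.mapLe (colourGraph_le c b)).edges) :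
      ∃ h : e ∈ G.edgeSet, c ⟨e, h⟩ = b := by
    rw [SimpleGraph.Walk.edges_mapLe_eq_edges] at he
    exact mem_edgeSet_colourGraph.1 (P.edges_subset_edgeSet he)
  have hcycle : (SimpleGraph.Walk.cons h (P.mapLe (colourGraph_le c b))).IsCycle := by
    refine (SimpleGraph.Walk.cons_isCycle_iff _ h).2 ⟨hP.mapLe _, fun he => hne (hedge _ he).2⟩
  rcases hc.2 u _ hcycle with ⟨d, hd⟩ | htwo
  · obtain ⟨e, heP⟩ : ∃ e, e ∈ P.edges := List.exists_mem_of_length_pos <| by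
      rw [SimpleGraph.Walk.length_edges]
      exact Nat.pos_of_ne_zero fun h0 => h.ne (SimpleGraph.Walk.eq_of_length_eq_zero h0).symm
    rw [← SimpleGraph.Walk.edges_mapLe_eq_edges P (h := colourGraph_le c b)] at heP
    obtain ⟨heG, hcol⟩ := hedge e heP
    have hed : c ⟨e, heG⟩ = d := hd _ (List.mem_cons_of_mem _ heP)
    exact hne ((hd _ List.mem_cons_self).trans (hed.symm.trans hcol))
  · have hsub : colouredEdges c (.cons h (P.mapLe (colourGraph_le c b))) (!b) ⊆
        {⟨s(u, v), h⟩} := by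
      rintro ⟨e, heG⟩ ⟨he, hcol⟩
      rcases List.mem_cons.1 he with heq | heP
      · exact Subtype.ext heq
      · simp [(hedge e heP).2] at hcol
    have hle := Set.ncard_le_ncard hsub
    rw [Set.ncard_singleton] at hle
    cases b
    · exact absurd (htwo.1.trans hle) (by omega)
    · exact absurd (htwo.2.trans hle) (by omega)

lemma isNACColouring_iff :
    IsNACColouring G c ↔ Function.Surjective c ∧ ∀ b, IsFlat c b := by
  refine ⟨fun h => ⟨h.1, h.isFlat⟩, fun ⟨hsurj, hflat⟩ => ⟨hsurj, fun v w hw => ?_⟩⟩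
  by_contra! hcon
  obtain ⟨hmono, htwo⟩ := hcon
  -- an edge whose colour no other edge of `w` has would be spanned by the edges of the other colour
  suffices htwo' : ∀ b, 2 ≤ (colouredEdges c w b).ncard from
    (htwo (htwo' true)).not_ge (htwo' false)
  intro b
  by_contra! hlt
  obtain ⟨e, hew, heb⟩ := hmono (!b)
  rw [Bool.ne_not] at heb
  have hfin : (colouredEdges c w b).Finite :=
    Set.Finite.of_finite_image ((List.finite_toSet w.edges).subset
      (by rintro _ ⟨e, he, rfl⟩; exact he.1)) Subtype.val_injective.injOn
  have hlone (f : G.edgeSet) (hfw : (f : Sym2 V) ∈ w.edges) (hfb : c f = b) : f = e :=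
    (Set.ncard_le_one hfin).1 (by omega) f ⟨hfw, hfb⟩ e ⟨hew, heb⟩
  obtain ⟨⟨x, y⟩, he⟩ := e
  let K := SimpleGraph.fromEdgeSet {f | f ∈ w.edges}
  have hwK : ∀ f ∈ w.edges, f ∈ K.edgeSet := fun f hf =>
    (SimpleGraph.edgeSet_fromEdgeSet _).symm ▸
      ⟨hf, G.not_isDiag_of_mem_edgeSet (w.edges_subset_edgeSet hf)⟩
  have hreach : (K.deleteEdges {s(x, y)}).Reachable x y :=
    (SimpleGraph.adj_and_reachable_delete_edges_iff_exists_cycle.2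
      ⟨v, w.transfer K hwK, hw.transfer hwK, by rwa [SimpleGraph.Walk.edges_transfer]⟩).2
  have hle : K.deleteEdges {s(x, y)} ≤ colourGraph c (!b) := by
    intro s t hst
    rw [SimpleGraph.deleteEdges_adj, SimpleGraph.fromEdgeSet_adj] at hst
    have hadj : G.Adj s t := w.edges_subset_edgeSet hst.1.1
    refine ⟨hadj, (Bool.eq_not).2 fun hb => hst.2 ?_⟩
    exact congrArg Subtype.val (hlone ⟨s(s, t), hadj⟩ hst.1.1 hb)
  exact absurd (heb.symm.trans (hflat (!b) he (hreach.mono hle))) (by simp)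

/-- Both colour classes are flats of the cycle matroid: `c` is a NAC-colouring or constant. -/
def IsBiflat (c : G.edgeSet → Bool) : Prop :=
  ∀ b, IsFlat c b

lemma colourGraph_compl (c : G.edgeSet → Bool) (b : Bool) :
    colourGraph cᶜ b = colourGraph c (!b) := by
  ext u v
  exact exists_congr fun _ => Bool.not_eq_eq_eq_not

lemma isFlat_compl_iff : IsFlat cᶜ b ↔ IsFlat c (!b) := by
  simp only [IsFlat, colourGraph_compl, Pi.compl_apply, Bool.compl_eq_bnot,
    Bool.not_eq_eq_eq_not]

lemma IsBiflat.compl (h : IsBiflat c) : IsBiflat cᶜ := fun b => isFlat_compl_iff.2 (h !b)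

lemma IsFlat.comp_hom {W : Type*} {H : SimpleGraph W} (hc : IsFlat c b) (φ : H →g G) :
    IsFlat (c ∘ φ.mapEdgeSet) b := by
  intro u v h hreach
  let ψ : colourGraph (c ∘ φ.mapEdgeSet) b →g colourGraph c b := ⟨φ, fun h => ⟨φ.map_adj h.1, h.2⟩⟩
  exact hc (φ.map_adj h) (hreach.map ψ)

lemma isBiflat_const (d : Bool) : IsBiflat (Function.const G.edgeSet d) := by
  rintro b u v h ⟨w⟩
  cases w with
  | nil => exact absurd rfl h.ne
  | cons h' _ => exact h'.2

lemma surjective_iff_ne_const {E : Type*} [Nonempty E] {c : E → Bool} :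
    Function.Surjective c ↔ ∀ d, c ≠ Function.const E d := by
  refine ⟨?_, fun h d => ?_⟩
  · rintro hc d rfl
    obtain ⟨_, hd⟩ := hc !d
    simp at hd
  · by_contra! hd
    exact h (!d) (funext fun e => Bool.eq_not.2 (hd e))

lemma ncard_isBiflat [Finite V] [Nonempty G.edgeSet] :
    {c : G.edgeSet → Bool | IsBiflat c}.ncard =
      {c : G.edgeSet → Bool | IsNACColouring G c}.ncard + 2 := by
  have hdiff : {c : G.edgeSet → Bool | IsNACColouring G c} =
      {c | IsBiflat c} \ Set.range (Function.const G.edgeSet) := by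
    ext c
    rw [Set.mem_sdiff, Set.mem_range, not_exists]
    exact isNACColouring_iff.trans (and_comm.trans (and_congr_right fun _ =>
      surjective_iff_ne_const.trans (forall_congr' fun _ => ne_comm)))
  have hsub : Set.range (Function.const G.edgeSet) ⊆ {c : G.edgeSet → Bool | IsBiflat c} :=
    Set.range_subset_iff.2 isBiflat_const
  have hrange : (Set.range (Function.const G.edgeSet : Bool → _)).ncard = 2 := by
    rw [Set.ncard_range_of_injective Function.const_injective, Nat.card_eq_fintype_card,
      Fintype.card_bool]
  rw [hdiff, ← hrange, Set.ncard_sdiff_add_ncard_of_subset hsub]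

lemma ncard_isBiflat_eq_two_mul [Finite V] (e : G.edgeSet) :
    {c : G.edgeSet → Bool | IsBiflat c}.ncard = 2 * {c | IsBiflat c ∧ c e = true}.ncard := by
  have hunion : {c : G.edgeSet → Bool | IsBiflat c} =
      {c | IsBiflat c ∧ c e = true} ∪ compl '' {c | IsBiflat c ∧ c e = true} := by
    ext c
    refine ⟨fun hc => ?_, ?_⟩
    · cases he : c e
      · exact .inr ⟨cᶜ, ⟨hc.compl, by simp [he]⟩, compl_compl c⟩
      · exact .inl ⟨hc, he⟩
    · rintro (hc | ⟨c, hc, rfl⟩)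
      · exact hc.1
      · exact hc.1.compl
  have hdisj : Disjoint {c : G.edgeSet → Bool | IsBiflat c ∧ c e = true}
      (compl '' {c | IsBiflat c ∧ c e = true}) := by
    rw [Set.disjoint_left]
    rintro _ ⟨_, he⟩ ⟨c, ⟨_, he'⟩, rfl⟩
    simp [he'] at he
  rw [hunion, Set.ncard_union_eq hdisj, Set.ncard_image_of_injective _ compl_injective, two_mul]

lemma nnac_add_one [Finite V] (e : G.edgeSet) :
    nnac G + 1 = Nat.card {c : G.edgeSet → Bool // IsBiflat c ∧ c e = true} := by
  have : Nonempty G.edgeSet := ⟨e⟩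
  have h : {c : G.edgeSet → Bool | IsNACColouring G c}.ncard + 2 =
      2 * Nat.card {c : G.edgeSet → Bool // IsBiflat c ∧ c e = true} :=
    ncard_isBiflat.symm.trans (ncard_isBiflat_eq_two_mul e)
  have h' := congrArg (Nat.cast (R := ℝ)) h
  push_cast at h'
  rw [nnac]
  linarith

/-- The edges of colour `b` are exactly the edges whose ends have the same label. -/
def IsLabelling (c : G.edgeSet → Bool) (b : Bool) (f : V → ℕ) : Prop :=
  ∀ ⦃u v⦄ (h : G.Adj u v), c ⟨s(u, v), h⟩ = b ↔ f u = f v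

lemma IsLabelling.comp_injective {f : V → ℕ} (hf : IsLabelling c b f) {g : ℕ → ℕ}
    (hg : g.Injective) : IsLabelling c b (g ∘ f) :=
  fun _ _ h => (hf h).trans hg.eq_iff.symm

lemma isFlat_iff_exists_isLabelling [Countable V] : IsFlat c b ↔ ∃ f, IsLabelling c b f := by
  constructor
  · intro hc
    have : Countable (colourGraph c b).ConnectedComponent := Quotient.countable
    obtain ⟨g, hg⟩ := Countable.exists_injective_nat (colourGraph c b).ConnectedComponent
    refine ⟨g ∘ (colourGraph c b).connectedComponentMk, fun u v h => ?_⟩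
    rw [Function.comp_apply, Function.comp_apply, hg.eq_iff, SimpleGraph.ConnectedComponent.eq]
    exact ⟨fun hb => SimpleGraph.Adj.reachable ⟨h, hb⟩, hc h⟩
  · rintro ⟨f, hf⟩ u v h ⟨w⟩
    have hconst {x y : V} (w : (colourGraph c b).Walk x y) : f x = f y := by
      induction w with
      | nil => rfl
      | cons h _ ih => exact ((hf h.1).1 h.2).trans ih
    exact (hf h).2 (hconst w)

lemma exists_injective_apply_eq_zero (m n : ℕ) :
    ∃ g : ℕ → ℕ, g.Injective ∧ g m = 0 ∧ g n = if m = n then 0 else 1 := by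
  refine ⟨(Equiv.swap m 0).trans (Equiv.swap (Equiv.swap m 0 n) (if m = n then 0 else 1)),
    Equiv.injective _, ?_, ?_⟩
  · by_cases h : m = n
    · simp [h]
    · have : Equiv.swap m 0 n ≠ 0 := fun h0 =>
        h ((Equiv.swap m 0).injective (h0.trans (Equiv.swap_apply_left m 0).symm)).symm
      simp [h, Equiv.swap_apply_of_ne_of_ne this.symm zero_ne_one]
  · simp

lemma IsFlat.exists_isLabelling_pinned [Countable V] (hc : IsFlat c b) {x y : V}
    (hxy : G.Adj x y) :
    ∃ f, IsLabelling c b f ∧ f x = 0 ∧ f y = if c ⟨s(x, y), hxy⟩ = b then 0 else 1 := by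
  obtain ⟨f, hf⟩ := isFlat_iff_exists_isLabelling.1 hc
  obtain ⟨g, hg, hx, hy⟩ := exists_injective_apply_eq_zero (f x) (f y)
  exact ⟨g ∘ f, hf.comp_injective hg, hx, hy.trans (if_congr (hf hxy).symm rfl rfl)⟩

end NACColouring

section GluedColourings

variable {V : Type*} [DecidableEq V] {H : SimpleGraph V} {a b : V} {k : ℕ}

lemma isFlat_glueCopies_iff [Countable V] (hab : H.Adj a b)
    {c : (glueCopies H a b k).edgeSet → Bool} {d : Bool} :
    IsFlat c d ↔ ∀ i, IsFlat (c ∘ (glueHom H a b k i).mapEdgeSet) d := by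
  refine ⟨fun h i => h.comp_hom _, fun h => isFlat_iff_exists_isLabelling.2 ?_⟩
  choose f hf hfa hfb using fun i => (h i).exists_isLabelling_pinned hab
  have hcab (i j : Fin k) : c ((glueHom H a b k i).mapEdgeSet ⟨s(a, b), hab⟩) =
      c ((glueHom H a b k j).mapEdgeSet ⟨s(a, b), hab⟩) :=
    congrArg c ((mapEdgeSet_glueHom_eq_iff hab.ne).2 ⟨rfl, .inr rfl⟩)
  obtain ⟨n, hn⟩ : ∃ n, ∀ i, f i b = n := by
    rcases isEmpty_or_nonempty (Fin k) with _ | ⟨⟨i₀⟩⟩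
    · exact ⟨0, isEmptyElim⟩
    · exact ⟨f i₀ b, fun i => by simp only [hfb, Function.comp_apply, hcab i i₀]⟩
  refine ⟨glueLift 0 n f, fun x y hxy => ?_⟩
  obtain ⟨i, -, u, v, huv, rfl, rfl⟩ := SimpleGraph.iSup_adj.1 hxy
  rw [glueLift_glueInclusion hab.ne hfa hn, glueLift_glueInclusion hab.ne hfa hn]
  exact hf i huv

lemma exists_comp_mapEdgeSet_glueHom_eq (hab : H.Adj a b) {α : Type*} [Nonempty α]
    {c : Fin k → H.edgeSet → α} (hc : ∀ i j, c i ⟨s(a, b), hab⟩ = c j ⟨s(a, b), hab⟩) :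
    ∃ C : (glueCopies H a b k).edgeSet → α, ∀ i, C ∘ (glueHom H a b k i).mapEdgeSet = c i := by
  have hfactors : Function.FactorsThrough (fun x : Fin k × H.edgeSet => c x.1 x.2)
      fun x => (glueHom H a b k x.1).mapEdgeSet x.2 := by
    rintro ⟨i, e⟩ ⟨j, f⟩ h
    obtain ⟨rfl, rfl | he⟩ := (mapEdgeSet_glueHom_eq_iff hab.ne).1 h
    · rfl
    · obtain rfl : e = ⟨s(a, b), hab⟩ := Subtype.ext he
      exact hc i j
  obtain ⟨C, hC⟩ := (Function.factorsThrough_iff _).1 hfactors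
  exact ⟨C, fun i => funext fun e => (congrFun hC (i, e)).symm⟩

lemma nnac_glueCopies_add_one [Finite V] (hab : H.Adj a b) (i₀ : Fin k) :
    nnac (glueCopies H a b k) + 1 = (nnac H + 1) ^ k := by
  let e₀ : H.edgeSet := ⟨s(a, b), hab⟩
  have he₀ (i : Fin k) :
      (glueHom H a b k i).mapEdgeSet e₀ = (glueHom H a b k i₀).mapEdgeSet e₀ :=
    (mapEdgeSet_glueHom_eq_iff hab.ne).2 ⟨rfl, .inr rfl⟩
  let restrict (c : {c : (glueCopies H a b k).edgeSet → Bool //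
      IsBiflat c ∧ c ((glueHom H a b k i₀).mapEdgeSet e₀) = true}) (i : Fin k) :
      {c : H.edgeSet → Bool // IsBiflat c ∧ c e₀ = true} :=
    ⟨c.1 ∘ (glueHom H a b k i).mapEdgeSet, fun d => (c.2.1 d).comp_hom _,
      (congrArg c.1 (he₀ i)).trans c.2.2⟩
  have hrestrict : restrict.Bijective := by
    constructor
    · intro c c' h
      refine Subtype.ext (funext fun e => ?_)
      obtain ⟨i, f, rfl⟩ := exists_mapEdgeSet_glueHom_eq e
      exact congrFun (congrArg Subtype.val (congrFun h i)) f
    · intro c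
      obtain ⟨C, hC⟩ := exists_comp_mapEdgeSet_glueHom_eq hab (c := fun i => (c i).1)
        fun i j => (c i).2.2.trans (c j).2.2.symm
      refine ⟨⟨C, fun d => (isFlat_glueCopies_iff hab).2 fun i => ?_,
        (congrFun (hC i₀) e₀).trans (c i₀).2.2⟩, funext fun i => Subtype.ext (hC i)⟩
      rw [hC]
      exact (c i).2.1 d
  rw [nnac_add_one ((glueHom H a b k i₀).mapEdgeSet e₀), nnac_add_one e₀,
    Nat.card_eq_of_bijective _ hrestrict, Nat.card_fun, Nat.card_fin, Nat.cast_pow]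

end GluedColourings

section Attaching

variable {n : ℕ}

/-- Whether a vertex joined to vertices with labels `x i` by edges of colours `c i` can be given a
label that agrees with `x i` exactly when `c i` is red. -/
def attachable (c : Fin n → Bool) (x : Fin n → ℕ) : Bool :=
  (List.finRange n).all fun i => !c i || (List.finRange n).all fun j => c j == (x i == x j)

lemma attachable_iff_forall {c : Fin n → Bool} {x : Fin n → ℕ} :
    attachable c x = true ↔ ∀ i, c i = true → ∀ j, c j = true ↔ x i = x j := by
  have hcolour (i j : Fin n) : c j = (x i == x j) ↔ (c j = true ↔ x i = x j) := by
    rw [Bool.eq_iff_iff, beq_iff_eq]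
  simp [attachable, hcolour, imp_iff_not_or]

lemma attachable_congr {c : Fin n → Bool} {x y : Fin n → ℕ} (h : ∀ i j, x i = x j ↔ y i = y j) :
    attachable c x = attachable c y := by
  rw [Bool.eq_iff_iff]
  simp only [attachable_iff_forall, h]

lemma attachable_iff_exists {c : Fin n → Bool} {x : Fin n → ℕ} :
    attachable c x = true ↔ ∃ l, ∀ i, c i = true ↔ l = x i := by
  rw [attachable_iff_forall]
  constructor
  · intro h
    by_cases hred : ∃ i, c i = true
    · obtain ⟨i, hi⟩ := hred
      exact ⟨x i, h i hi⟩
    · obtain ⟨l, hl⟩ := (Set.finite_range x).exists_notMem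
      exact ⟨l, fun i => iff_of_false (fun hi => hred ⟨i, hi⟩) fun h => hl ⟨i, h.symm⟩⟩
  · rintro ⟨l, hl⟩ i hi j
    rw [← (hl i).1 hi, hl j]

/-- Whether a path of two vertices, the first joined to vertices with labels `x 0` and `x 1` by
edges of colours `c 0` and `c 1`, the second joined to the first and to a vertex with label `x 2`
by edges of colours `c 2` and `c 3`, can be labelled. -/
def pathAttachable (c : Fin 4 → Bool) (x : Fin 3 → ℕ) : Bool :=
  if c 2 || c 3 then attachable ![c 0, c 1, c 2 && c 3] x
  else attachable ![c 0, c 1] ![x 0, x 1]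

lemma pathAttachable_congr {c : Fin 4 → Bool} {x y : Fin 3 → ℕ}
    (h : ∀ i j, x i = x j ↔ y i = y j) : pathAttachable c x = pathAttachable c y := by
  have h₂ : ∀ i j, ![x 0, x 1] i = ![x 0, x 1] j ↔ ![y 0, y 1] i = ![y 0, y 1] j := by
    simpa [Fin.forall_fin_two] using ⟨h 0 1, h 1 0⟩
  rw [pathAttachable, pathAttachable, attachable_congr h, attachable_congr h₂]

lemma pathAttachable_iff_exists {c : Fin 4 → Bool} {x : Fin 3 → ℕ} :
    pathAttachable c x = true ↔ ∃ l l' : ℕ, (c 0 = true ↔ l = x 0) ∧ (c 1 = true ↔ l = x 1) ∧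
      (c 2 = true ↔ l' = l) ∧ (c 3 = true ↔ l' = x 2) := by
  have second_vertex (l : ℕ) : (∃ l', (c 2 = true ↔ l' = l) ∧ (c 3 = true ↔ l' = x 2)) ↔
      ((c 2 || c 3) = true → ((c 2 && c 3) = true ↔ l = x 2)) := by
    obtain ⟨m, hm⟩ := ({l, x 2} : Set ℕ).toFinite.exists_notMem
    rw [Set.mem_insert_iff, Set.mem_singleton_iff, not_or] at hm
    cases c 2 <;> cases c 3
    · simpa using ⟨m, hm⟩
    · simp [eq_comm]
    · simp
    · simp
  simp only [exists_and_left, second_vertex, pathAttachable]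
  split_ifs with h
  · simp [attachable_iff_exists, Fin.forall_fin_succ, h]
  · simp [attachable_iff_exists, Fin.forall_fin_succ, h]

end Attaching

section MaskCounting

/-- The number of colourings `d` such that the conditions `F d` and `F dᶜ` hold for some bit of
`s` and of `t` respectively; `d` gives the colour red and `dᶜ` the colour blue the value `true`. -/
noncomputable def compatibleCount {D : Type*} [Compl D] (F : D → ℕ → Prop) (s t : ℕ) : ℕ :=
  Nat.card {d // (∃ i, s.testBit i = true ∧ F d i) ∧ ∃ i, t.testBit i = true ∧ F dᶜ i}

/-- The sum of a function over all colourings of `n` edges. -/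
def sumColourings : (n : ℕ) → ((Fin n → Bool) → ℕ) → ℕ
  | 0, F => F ![]
  | n + 1, F => sumColourings n (fun c => F (Fin.cons true c)) +
      sumColourings n (fun c => F (Fin.cons false c))

/-- Extend a count by the colourings of `n` more edges, the colouring `c` being compatible with
the bits of `m c`. The matches discard empty masks and force the kernel to evaluate the others. -/
def branch {n : ℕ} (m : (Fin n → Bool) → ℕ) (count : ℕ → ℕ → ℕ) : ℕ → ℕ → ℕ
  | 0, _ => 0
  | _ + 1, 0 => 0
  | s + 1, t + 1 => sumColourings n fun c => count ((s + 1) &&& m c) ((t + 1) &&& m cᶜ)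

lemma sumColourings_eq_sum : ∀ (n : ℕ) (F : (Fin n → Bool) → ℕ), sumColourings n F = ∑ c, F c
  | 0, F => (Fintype.sum_unique F).symm
  | n + 1, F => by
    rw [sumColourings, sumColourings_eq_sum, sumColourings_eq_sum,
      ← (Fin.consEquiv fun _ => Bool).sum_comp, Fintype.sum_prod_type, Fintype.sum_bool]
    rfl

lemma compatibleCount_zero_left {D : Type*} [Compl D] (F : D → ℕ → Prop) (t : ℕ) :
    compatibleCount F 0 t = 0 := by
  simp [compatibleCount]

lemma compatibleCount_zero_right {D : Type*} [Compl D] (F : D → ℕ → Prop) (s : ℕ) :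
    compatibleCount F s 0 = 0 := by
  simp [compatibleCount]

lemma compatibleCount_congr {D E : Type*} [Compl D] [Compl E] {F : D → ℕ → Prop}
    {F' : E → ℕ → Prop} (φ : D ≃ E) (hφ : ∀ d, φ dᶜ = (φ d)ᶜ) (h : ∀ d i, F d i ↔ F' (φ d) i) :
    compatibleCount F = compatibleCount F' := by
  funext s t
  exact Nat.card_congr (φ.subtypeEquiv fun d => by simp only [h, hφ])

lemma branch_compatibleCount {n : ℕ} {D : Type*} [Finite D] [Compl D] (m : (Fin n → Bool) → ℕ)
    (F : D → ℕ → Prop) :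
    branch m (compatibleCount F) = compatibleCount fun (x : (Fin n → Bool) × D) i =>
      (m x.1).testBit i = true ∧ F x.2 i := by
  funext s t
  rcases s with _ | s
  · rw [compatibleCount_zero_left, branch]
  rcases t with _ | t
  · rw [compatibleCount_zero_right, branch]
  have hfibre (c : Fin n → Bool) :
      compatibleCount F ((s + 1) &&& m c) ((t + 1) &&& m cᶜ) =
        Nat.card {d // (∃ i, (s + 1).testBit i = true ∧ (m c).testBit i = true ∧ F d i) ∧
          ∃ i, (t + 1).testBit i = true ∧ (m cᶜ).testBit i = true ∧ F dᶜ i} := by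
    simp only [compatibleCount, Nat.testBit_land, Bool.and_eq_true, and_assoc]
  simp only [branch, sumColourings_eq_sum, hfibre]
  rw [← Nat.card_sigma]
  exact Nat.card_congr (Equiv.subtypeProdEquivSigmaSubtype _).symm

lemma branch_iterate_compatibleCount {n : ℕ} {D : Type*} [Finite D] [Compl D]
    (m : (Fin n → Bool) → ℕ) (F : D → ℕ → Prop) (j : ℕ) :
    (branch m)^[j] (compatibleCount F) =
      compatibleCount fun (x : (Fin j → Fin n → Bool) × D) i =>
        (∀ l, (m (x.1 l)).testBit i = true) ∧ F x.2 i := by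
  induction j with
  | zero =>
    exact compatibleCount_congr (Equiv.uniqueProd D _).symm
      (fun _ => Prod.ext (Subsingleton.elim _ _) rfl) (by simp)
  | succ j ih =>
    rw [Function.iterate_succ_apply', ih, branch_compatibleCount]
    refine compatibleCount_congr ((Equiv.prodAssoc _ _ _).symm.trans
      ((Fin.consEquiv fun _ => Fin n → Bool).prodCongr (Equiv.refl D))) (fun x => ?_) fun x i => ?_
    · refine Prod.ext (funext fun l => ?_) rfl
      refine l.cases rfl fun _ => rfl
    · simp [Fin.forall_fin_succ, Fin.consEquiv, and_assoc]

lemma compatibleCount_true :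
    compatibleCount (fun (_ : Unit) _ => True) = fun s t => if s = 0 ∨ t = 0 then 0 else 1 := by
  funext s t
  split_ifs with h
  · rcases h with rfl | rfl
    exacts [compatibleCount_zero_left .., compatibleCount_zero_right ..]
  · rw [not_or] at h
    have hs := Nat.exists_testBit_of_ne_zero h.1
    have ht := Nat.exists_testBit_of_ne_zero h.2
    simp [compatibleCount, hs, ht]

end MaskCounting

section CoreStates

lemma exists_le_and_apply_eq_iff {ι α : Type*} [LinearOrder ι] [WellFoundedLT ι] (x : ι → α) :
    ∃ r : ι → ι, (∀ i, r i ≤ i) ∧ ∀ i j, r i = r j ↔ x i = x j := by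
  let r (i : ι) : ι := wellFounded_lt.min {j | x j = x i} ⟨i, rfl⟩
  have hr (i : ι) : x (r i) = x i := wellFounded_lt.min_mem {j | x j = x i} ⟨i, rfl⟩
  refine ⟨r, fun i => wellFounded_lt.min_le (s := {j | x j = x i}) rfl,
    fun i j => ⟨fun h => ?_, fun h => ?_⟩⟩
  · rw [← hr i, h, hr]
  · simp only [r, h]

/-- The labels of the core vertices `1, 3, 5, 8, 9` in the state `s < 120`: the `i`-th label is a
digit of `s` in mixed radix, between `0` and `i`. -/
def coreLabels (s : ℕ) : Fin 5 → ℕ :=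
  ![0, s % 2, s / 2 % 3, s / 6 % 4, s / 24]

lemma exists_coreLabels_eq_iff {α : Type*} (x : Fin 5 → α) :
    ∃ s < 120, ∀ i j, coreLabels s i = coreLabels s j ↔ x i = x j := by
  obtain ⟨r, hr, hrx⟩ := exists_le_and_apply_eq_iff x
  have h0 : (r 0 : ℕ) ≤ 0 := hr 0
  have h1 : (r 1 : ℕ) ≤ 1 := hr 1
  have h2 : (r 2 : ℕ) ≤ 2 := hr 2
  have h3 : (r 3 : ℕ) ≤ 3 := hr 3
  have h4 : (r 4 : ℕ) ≤ 4 := hr 4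
  let s : ℕ := r 1 + 2 * (r 2 + 3 * (r 3 + 4 * r 4))
  have hs (i : Fin 5) : coreLabels s i = r i := by
    fin_cases i <;> simp [coreLabels, s] <;> omega
  exact ⟨s, by omega, fun i j => by rw [hs, hs, Fin.val_inj, hrx]⟩

/-- The set of states whose core labels satisfy `P`, as a bit mask. -/
def stateMask (P : (Fin 5 → ℕ) → Bool) : ℕ :=
  Nat.ofBits fun s : Fin 120 => P (coreLabels s)

lemma testBit_stateMask {P : (Fin 5 → ℕ) → Bool} {s : ℕ} :
    (stateMask P).testBit s = true ↔ s < 120 ∧ P (coreLabels s) = true := by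
  rw [stateMask, Nat.testBit_ofBits]
  grind

end CoreStates

section BaseEdges

instance : DecidableRel baseGraph.Adj :=
  inferInstanceAs (DecidableRel (SimpleGraph.fromRel _).Adj)

/-- The edges of the base graph, grouped as in `baseEdgeEnds`: two edges between core vertices,
three vertices attached to `1, 3, 5`, two vertices attached to `1, 5, 9`, and four paths of two
vertices attached to `1, 5, 8`. -/
abbrev BaseEdge : Type :=
  Fin 2 ⊕ Fin 3 × Fin 3 ⊕ Fin 2 × Fin 3 ⊕ Fin 4 × Fin 4

/-- The ends of an edge of the base graph. -/
def baseEdgeEnds : BaseEdge → Fin 18 × Fin 18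
  | .inl i => (![3, 8] i, ![8, 9] i)
  | .inr (.inl (i, j)) => (![2, 4, 11] i, ![1, 3, 5] j)
  | .inr (.inr (.inl (i, j))) => (![0, 10] i, ![1, 5, 9] j)
  | .inr (.inr (.inr (i, j))) =>
    let w : Fin 18 := ![6, 12, 14, 16] i
    ![(w, 1), (w, 5), (w + 1, w), (w + 1, 8)] j

lemma baseGraph_adj_baseEdgeEnds :
    ∀ e, baseGraph.Adj (baseEdgeEnds e).1 (baseEdgeEnds e).2 := by
  decide

/-- `baseEdgeEnds` as an enumeration of the edges of the base graph. -/
noncomputable def baseEdgeEquiv : BaseEdge ≃ baseGraph.edgeSet :=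
  Equiv.ofBijective (fun e => ⟨s((baseEdgeEnds e).1, (baseEdgeEnds e).2),
    baseGraph_adj_baseEdgeEnds e⟩) <| by
    constructor
    · have h : ∀ e f, s((baseEdgeEnds e).1, (baseEdgeEnds e).2) =
        s((baseEdgeEnds f).1, (baseEdgeEnds f).2) → e = f := by decide +kernel
      exact fun e f hef => h e f (congrArg Subtype.val hef)
    · have h : ∀ u v, baseGraph.Adj u v →
        ∃ e, s((baseEdgeEnds e).1, (baseEdgeEnds e).2) = s(u, v) := by decide +kernel
      rintro ⟨⟨u, v⟩, huv⟩
      obtain ⟨e, he⟩ := h u v huv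
      exact ⟨e, Subtype.ext he⟩

end BaseEdges

section BaseCount

/-- The colours of the two edges between core vertices agree with the core labels `x`. -/
def coreEdgesFit (c : Fin 2 → Bool) (x : Fin 5 → ℕ) : Bool :=
  (c 0 == (x 1 == x 3)) && (c 1 == (x 3 == x 4))

lemma coreEdgesFit_iff {c : Fin 2 → Bool} {x : Fin 5 → ℕ} :
    coreEdgesFit c x = true ↔ (c 0 = true ↔ x 1 = x 3) ∧ (c 1 = true ↔ x 3 = x 4) := by
  rw [coreEdgesFit, Bool.and_eq_true]
  cases c 0 <;> cases c 1 <;> simp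

/-- The edge colourings of the base graph, grouped as the edges are in `baseEdgeEnds`. -/
abbrev BaseColouring : Type :=
  (Fin 2 → Bool) × (Fin 3 → Fin 3 → Bool) × (Fin 2 → Fin 3 → Bool) × (Fin 4 → Fin 4 → Bool)

/-- The core labels `x` extend to a labelling of the base graph whose monochromatic edges are the
red edges of `d`. -/
def FitsCore (d : BaseColouring) (x : Fin 5 → ℕ) : Prop :=
  coreEdgesFit d.1 x = true ∧ (∀ i, attachable (d.2.1 i) (x ∘ ![0, 1, 2]) = true) ∧
    (∀ i, attachable (d.2.2.1 i) (x ∘ ![0, 2, 4]) = true) ∧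
    ∀ i, pathAttachable (d.2.2.2 i) (x ∘ ![0, 2, 3]) = true

lemma FitsCore.congr {d : BaseColouring} {x y : Fin 5 → ℕ} (h : ∀ i j, x i = x j ↔ y i = y j)
    (hx : FitsCore d x) : FitsCore d y := by
  refine ⟨?_, fun i => ?_, fun i => ?_, fun i => ?_⟩
  · simpa only [coreEdgesFit_iff, h] using hx.1
  · exact (attachable_congr fun _ _ => h _ _).symm.trans (hx.2.1 i)
  · exact (attachable_congr fun _ _ => h _ _).symm.trans (hx.2.2.1 i)
  · exact (pathAttachable_congr fun _ _ => h _ _).symm.trans (hx.2.2.2 i)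

/-- The grouping of the colours of the edges of the base graph. -/
noncomputable def baseColouringEquiv : (baseGraph.edgeSet → Bool) ≃ BaseColouring :=
  (baseEdgeEquiv.symm.arrowCongr (Equiv.refl Bool)).trans <|
    (Equiv.sumArrowEquivProdArrow ..).trans <| (Equiv.refl _).prodCongr <|
      (Equiv.sumArrowEquivProdArrow ..).trans <| (Equiv.curry ..).prodCongr <|
        (Equiv.sumArrowEquivProdArrow ..).trans <| (Equiv.curry ..).prodCongr (Equiv.curry ..)

lemma isLabelling_base_iff {c : baseGraph.edgeSet → Bool} {f : Fin 18 → ℕ} :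
    IsLabelling c true f ↔
      ∀ e, c (baseEdgeEquiv e) = true ↔ f (baseEdgeEnds e).1 = f (baseEdgeEnds e).2 := by
  refine ⟨fun h e => h _, fun h u v huv => ?_⟩
  obtain ⟨e, he⟩ := baseEdgeEquiv.surjective ⟨s(u, v), huv⟩
  rw [← he, h]
  rcases Sym2.eq_iff.1 (congrArg Subtype.val he) with ⟨hu, hv⟩ | ⟨hu, hv⟩
  · rw [hu, hv]
  · rw [hu, hv, eq_comm]

lemma isFlat_true_iff_exists_fitsCore {c : baseGraph.edgeSet → Bool} :
    IsFlat c true ↔ ∃ x, FitsCore (baseColouringEquiv c) x := by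
  rw [isFlat_iff_exists_isLabelling]
  constructor
  · rintro ⟨f, hf⟩
    rw [isLabelling_base_iff] at hf
    simp only [Sum.forall, Prod.forall] at hf
    obtain ⟨h1, h2, h3, h4⟩ := hf
    refine ⟨f ∘ ![1, 3, 5, 8, 9], ?_, fun i => ?_, fun i => ?_, fun i => ?_⟩
    · exact coreEdgesFit_iff.2 ⟨h1 0, h1 1⟩
    · refine attachable_iff_exists.2 ⟨f (![2, 4, 11] i), fun j => ?_⟩
      fin_cases j <;> exact h2 i _
    · refine attachable_iff_exists.2 ⟨f (![0, 10] i), fun j => ?_⟩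
      fin_cases j <;> exact h3 i _
    · exact pathAttachable_iff_exists.2 ⟨f (![6, 12, 14, 16] i), f (![6, 12, 14, 16] i + 1),
        h4 i 0, h4 i 1, h4 i 2, h4 i 3⟩
  · rintro ⟨x, h1, h2, h3, h4⟩
    simp only [attachable_iff_exists, pathAttachable_iff_exists] at h2 h3 h4
    choose l2 h2 using h2
    choose l3 h3 using h3
    choose l4 l4' h4 using h4
    refine ⟨![l3 0, x 0, l2 0, x 1, l2 1, x 2, l4 0, l4' 0, x 3, x 4, l3 1, l2 2, l4 1, l4' 1,
      l4 2, l4' 2, l4 3, l4' 3], isLabelling_base_iff.2 ?_⟩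
    simp only [Sum.forall, Prod.forall]
    refine ⟨fun i => ?_, fun i j => ?_, fun i j => ?_, fun i j => ?_⟩
    · fin_cases i
      exacts [(coreEdgesFit_iff.1 h1).1, (coreEdgesFit_iff.1 h1).2]
    · fin_cases i <;> fin_cases j <;> exact h2 _ _
    · fin_cases i <;> fin_cases j <;> exact h3 _ _
    · fin_cases i <;> fin_cases j
      all_goals first
        | exact (h4 _).1 | exact (h4 _).2.1 | exact (h4 _).2.2.1 | exact (h4 _).2.2.2

lemma isFlat_true_iff_exists_testBit {c : baseGraph.edgeSet → Bool} :
    IsFlat c true ↔ ∃ s, (2 ^ 120 - 1).testBit s = true ∧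
      s < 120 ∧ FitsCore (baseColouringEquiv c) (coreLabels s) := by
  simp only [isFlat_true_iff_exists_fitsCore, Nat.testBit_two_pow_sub_one, decide_eq_true_eq,
    ← and_assoc, and_self]
  refine ⟨fun ⟨x, hx⟩ => ?_, fun ⟨s, _, hs⟩ => ⟨_, hs⟩⟩
  obtain ⟨s, hs, hsx⟩ := exists_coreLabels_eq_iff x
  exact ⟨s, hs, hx.congr fun i j => (hsx i j).symm⟩

lemma ncard_isBiflat_base : {c : baseGraph.edgeSet → Bool | IsBiflat c}.ncard =
    compatibleCount (fun c s => s < 120 ∧ FitsCore (baseColouringEquiv c) (coreLabels s))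
      (2 ^ 120 - 1) (2 ^ 120 - 1) := by
  refine Nat.card_congr (Equiv.subtypeEquivRight fun c => ?_)
  rw [← isFlat_true_iff_exists_testBit, ← isFlat_true_iff_exists_testBit, isFlat_compl_iff,
    and_comm]
  exact Bool.forall_bool

/-- The number of colourings of the base graph both of whose colour classes fit some core labels,
evaluated group by group. The two masks hold the states of the core that are compatible with the
colours so far, as red and as blue edges respectively. -/
def baseCount : ℕ :=
  branch (fun c => stateMask (coreEdgesFit c))
    ((branch fun c => stateMask fun x => attachable c (x ∘ ![0, 1, 2]))^[3]
      ((branch fun c => stateMask fun x => attachable c (x ∘ ![0, 2, 4]))^[2]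
        ((branch fun c => stateMask fun x => pathAttachable c (x ∘ ![0, 2, 3]))^[4]
          fun s t => if s = 0 ∨ t = 0 then 0 else 1)))
    (2 ^ 120 - 1) (2 ^ 120 - 1)

lemma compatibleCount_fitsCore :
    compatibleCount (fun c s => s < 120 ∧ FitsCore (baseColouringEquiv c) (coreLabels s))
      (2 ^ 120 - 1) (2 ^ 120 - 1) = baseCount := by
  rw [baseCount, ← compatibleCount_true, branch_iterate_compatibleCount,
    branch_iterate_compatibleCount, branch_iterate_compatibleCount, branch_compatibleCount]
  refine congrFun₂ (compatibleCount_congr (baseColouringEquiv.trans <| (Equiv.refl _).prodCongr <|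
    (Equiv.refl _).prodCongr <| (Equiv.refl _).prodCongr (Equiv.prodPUnit _).symm)
    (fun _ => rfl) fun c s => ?_) _ _
  simp only [testBit_stateMask, FitsCore]
  exact ⟨fun ⟨hs, h1, h2, h3, h4⟩ =>
      ⟨⟨hs, h1⟩, fun i => ⟨hs, h2 i⟩, fun i => ⟨hs, h3 i⟩, fun i => ⟨hs, h4 i⟩, trivial⟩,
    fun ⟨h1, h2, h3, h4, _⟩ =>
      ⟨h1.1, h1.2, fun i => (h2 i).2, fun i => (h3 i).2, fun i => (h4 i).2⟩⟩

lemma baseCount_eq : baseCount = 361216 := by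
  decide +kernel

lemma nnac_baseGraph : nnac baseGraph = 180607 := by
  have hadj : baseGraph.Adj 0 1 := by decide
  have : Nonempty baseGraph.edgeSet := ⟨⟨s(0, 1), hadj⟩⟩
  have h : {c : baseGraph.edgeSet → Bool | IsNACColouring baseGraph c}.ncard + 2 = 361216 := by
    rw [← ncard_isBiflat, ncard_isBiflat_base, compatibleCount_fitsCore, baseCount_eq]
  rw [nnac, Nat.eq_sub_of_add_eq h]
  norm_num

end BaseCount

section BaseRigidity

lemma IsInfinitesimalMotion.eq_zero_of_adj_adj {V : Type*} {G : SimpleGraph V}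
    {p q : Realisation V 2} (hq : IsInfinitesimalMotion G p q) {u v w : V} (huv : G.Adj u v)
    (huw : G.Adj u w) (hv : q v = 0) (hw : q w = 0)
    (hdet : (p u 0 - p v 0) * (p u 1 - p w 1) - (p u 1 - p v 1) * (p u 0 - p w 0) ≠ 0) :
    q u = 0 := by
  have h₁ := hq huv
  have h₂ := hq huw
  simp only [hv, hw, sub_zero, PiLp.inner_apply, PiLp.sub_apply, RCLike.inner_apply, conj_trivial,
    Fin.sum_univ_two] at h₁ h₂
  refine PiLp.ext (Fin.forall_fin_two.2 ⟨?_, ?_⟩)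
  · exact (mul_eq_zero_iff_right hdet).1 (by
      linear_combination (p u 1 - p w 1) * h₁ - (p u 1 - p v 1) * h₂)
  · exact (mul_eq_zero_iff_right hdet).1 (by
      linear_combination (p u 0 - p v 0) * h₂ - (p u 0 - p w 0) * h₁)

/-- The coordinates of a realisation of the base graph. The vertices `1, 3, 5` and `2, 4, 11`,
which induce a complete bipartite graph, do not lie on a conic. -/
def baseCoord : Fin 18 → Fin 2 → ℤ :=
  ![![1, 1], ![0, 0], ![1, 0], ![1, 2], ![0, 1], ![3, 1], ![2, 0], ![7, 1], ![-1, 1], ![5, -3],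
    ![0, -1], ![2, 3], ![1, 3], ![1, 5], ![1, -2], ![2, 2], ![-1, 2], ![3, 5]]

/-- The realisation of the base graph with coordinates `baseCoord`. -/
noncomputable def baseRealisation : Realisation (Fin 18) 2 :=
  fun v => WithLp.toLp 2 fun i => (baseCoord v i : ℝ)

lemma baseRealisation_injective : Function.Injective baseRealisation := by
  have hcoord : Function.Injective baseCoord := by decide
  intro u v huv
  exact hcoord (funext fun i => by
    simpa [baseRealisation] using congrArg (fun x => x i) huv)

variable {q : Realisation (Fin 18) 2}

lemma IsInfinitesimalMotion.base_core_eq_zero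
    (hq : IsInfinitesimalMotion baseGraph baseRealisation q) (h₁ : q 1 = 0) (h₂ : q 2 = 0) :
    q 3 = 0 ∧ q 4 = 0 ∧ q 5 = 0 ∧ q 11 = 0 := by
  have edge_eq {u v} (x y : ℤ) (huv : baseGraph.Adj u v)
      (hxy : baseCoord u - baseCoord v = ![x, y]) :
      (x : ℝ) * (q u 0 - q v 0) + (y : ℝ) * (q u 1 - q v 1) = 0 := by
    have hx := congrFun hxy 0
    have hy := congrFun hxy 1
    simp only [Pi.sub_apply, Matrix.cons_val_zero, Matrix.cons_val_one] at hx hy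
    simpa [baseRealisation, PiLp.inner_apply, ← hx, ← hy, mul_comm] using hq huv
  have h₁₄ := edge_eq (u := 1) (v := 4) 0 (-1) (by decide) (by decide)
  have h₂₃ := edge_eq (u := 2) (v := 3) 0 (-2) (by decide) (by decide)
  have h₂₅ := edge_eq (u := 2) (v := 5) (-2) (-1) (by decide) (by decide)
  have h₃₄ := edge_eq (u := 3) (v := 4) 1 1 (by decide) (by decide)
  have h₄₅ := edge_eq (u := 4) (v := 5) (-3) 0 (by decide) (by decide)
  have h₁₁₁ := edge_eq (u := 1) (v := 11) (-2) (-3) (by decide) (by decide)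
  have h₃₁₁ := edge_eq (u := 3) (v := 11) (-1) (-1) (by decide) (by decide)
  have h₅₁₁ := edge_eq (u := 5) (v := 11) 1 (-2) (by decide) (by decide)
  norm_num [h₁, h₂] at h₁₄ h₂₃ h₂₅ h₃₄ h₄₅ h₁₁₁ h₃₁₁ h₅₁₁
  simp only [PiLp.ext_iff, Fin.forall_fin_two, PiLp.zero_apply]
  refine ⟨⟨?_, ?_⟩, ⟨?_, ?_⟩, ⟨?_, ?_⟩, ?_, ?_⟩ <;> linarith

lemma isInfinitesimallyRigid_baseRealisation :
    IsInfinitesimallyRigid baseGraph baseRealisation := by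
  rw [isInfinitesimallyRigid_iff_pinned (a := 1) (b := 2) (by decide)
    (baseRealisation_injective.ne (by decide))]
  intro q hq h1 h2
  obtain ⟨h3, h4, h5, h11⟩ := hq.base_core_eq_zero h1 h2
  have attach {u v w} (hv : q v = 0) (hw : q w = 0) (huv : baseGraph.Adj u v)
      (huw : baseGraph.Adj u w) (hdet : (baseCoord u 0 - baseCoord v 0) *
        (baseCoord u 1 - baseCoord w 1) - (baseCoord u 1 - baseCoord v 1) *
        (baseCoord u 0 - baseCoord w 0) ≠ 0) : q u = 0 :=
    hq.eq_zero_of_adj_adj huv huw hv hw (by simpa [baseRealisation] using mod_cast hdet)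
  have h0 : q 0 = 0 := attach h1 h5 (by decide) (by decide) (by decide)
  have h10 : q 10 = 0 := attach h1 h5 (by decide) (by decide) (by decide)
  have h9 : q 9 = 0 := attach h0 h10 (by decide) (by decide) (by decide)
  have h8 : q 8 = 0 := attach h3 h9 (by decide) (by decide) (by decide)
  have h6 : q 6 = 0 := attach h1 h5 (by decide) (by decide) (by decide)
  have h12 : q 12 = 0 := attach h1 h5 (by decide) (by decide) (by decide)
  have h14 : q 14 = 0 := attach h1 h5 (by decide) (by decide) (by decide)
  have h16 : q 16 = 0 := attach h1 h5 (by decide) (by decide) (by decide)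
  have h7 : q 7 = 0 := attach h6 h8 (by decide) (by decide) (by decide)
  have h13 : q 13 = 0 := attach h12 h8 (by decide) (by decide) (by decide)
  have h15 : q 15 = 0 := attach h14 h8 (by decide) (by decide) (by decide)
  have h17 : q 17 = 0 := attach h16 h8 (by decide) (by decide) (by decide)
  funext v
  fin_cases v <;> assumption

lemma card_edgeSet_baseGraph : Nat.card baseGraph.edgeSet = 33 := by
  rw [← Nat.card_congr baseEdgeEquiv, Nat.card_eq_fintype_card]
  rfl

end BaseRigidity

lemma isLittleO_pow_affine {x y : ℝ} {m : ℕ} (n : ℕ) (hx : 0 ≤ x) (hy : 1 < y)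
    (hxy : x ^ m < y) : (fun k : ℕ => x ^ (m * k + n)) =o[atTop] fun k : ℕ => y ^ k - 1 := by
  have hpow : (fun k : ℕ => (x ^ m) ^ k) =o[atTop] fun k : ℕ => y ^ k :=
    isLittleO_pow_pow_of_lt_left (pow_nonneg hx m) hxy
  have hone : (fun _ : ℕ => (1 : ℝ)) =o[atTop] fun k : ℕ => y ^ k := by
    simpa only [one_pow] using isLittleO_pow_pow_of_lt_left zero_le_one hy
  have hequiv : (fun k : ℕ => y ^ k - 1) ~[atTop] fun k : ℕ => y ^ k :=
    IsEquivalent.refl.sub_isLittleO hone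
  simpa only [pow_add, pow_mul, mul_comm] using
    (hpow.const_mul_left (x ^ n)).trans_isBigO hequiv.symm.isBigO

theorem corollary5p6 :
    IsMinimallyRigid baseGraph ∧ nnac baseGraph = 180607 ∧
      ∀ a b : Fin 18, baseGraph.Adj a b →
        (∀ k : ℕ, 1 ≤ k →
          IsMinimallyRigid (glueCopies baseGraph a b k) ∧
          Fintype.card (GlueVertex a b k) = 16 * k + 2 ∧
          nnac (glueCopies baseGraph a b k) = (nnac baseGraph + 1) ^ k - 1) ∧
        (fun k : ℕ => (2.13 : ℝ) ^ Fintype.card (GlueVertex a b k))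
          =o[atTop] (fun k : ℕ => nnac (glueCopies baseGraph a b k)) := by
  have hcount : Nat.card baseGraph.edgeSet + 3 = 2 * Nat.card (Fin 18) := by
    rw [card_edgeSet_baseGraph, Nat.card_fin]
  refine ⟨isMinimallyRigid_of_isInfinitesimallyRigid (a := 0) (b := 1) hcount (by decide)
    (baseRealisation_injective.ne (by decide)) isInfinitesimallyRigid_baseRealisation,
    nnac_baseGraph, fun a b hab => ?_⟩
  have hcard (k : ℕ) : Fintype.card (GlueVertex a b k) = 16 * k + 2 := by
    rw [← Nat.card_eq_fintype_card, card_glueVertex hab.ne, Nat.card_fin, mul_comm]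
  have hnnac (k : ℕ) (hk : 1 ≤ k) :
      nnac (glueCopies baseGraph a b k) = (nnac baseGraph + 1) ^ k - 1 :=
    eq_sub_of_add_eq (nnac_glueCopies_add_one hab ⟨0, hk⟩)
  refine ⟨fun k hk => ⟨isMinimallyRigid_glueCopies hcount hab (baseRealisation_injective.ne hab.ne)
    isInfinitesimallyRigid_baseRealisation ⟨0, hk⟩, hcard k, hnnac k hk⟩, ?_⟩
  simp only [hcard]
  have hgrowth : (fun k : ℕ => (2.13 : ℝ) ^ (16 * k + 2)) =o[atTop]
      fun k : ℕ => (nnac baseGraph + 1) ^ k - 1 := by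
    rw [nnac_baseGraph]
    exact isLittleO_pow_affine 2 (by norm_num) (by norm_num) (by norm_num)
  refine hgrowth.trans_eventuallyEq ?_
  filter_upwards [eventually_ge_atTop 1] with k hk using (hnnac k hk).symm
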